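/- Let $G$ be a finite group. For a 2-cocycle $f\in Z^2(G,\mathbb{C}^*)$ (with $G$ acting trivially on $\mathbb{C}^*$), the twisted group algebra $\mathbb{C}^fG$ is the complex algebra with basis $\{u_g\}_{g\in G}$ and multiplication $u_gu_h=f(g,h)u_{gh}$. The cocycle $f$, and its class $[f]\in H^2(G,\mathbb{C}^*)$, is called non-degenerate if $\mathbb{C}^fG\cong M_n(\mathbb{C})$ for some $n$, and $G$ is said to be of central type if it admits a non-degenerate 2-cocycle. An action $\eta:K\to\mathrm{Aut}(N)$ of a group $K$ on $N$ is symplectic if there is a non-degenerate class in $H^2(N,\mathbb{C}^*)$ fixed by $\eta(K)$, where $\phi\in\mathrm{Aut}(N)$ acts by $\phi([f])=[f(\phi^{-1}(\cdot),\phi^{-1}(\cdot))]$. Write $C_m$ for the cyclic group of order $m$, and let $\mathrm{SL}_2(m)=\mathrm{SL}_2(\mathbb{Z}/m)$ act naturally on $C_m\times C_m=(\mathbb{Z}/m)^2$. Theorem. Let $p<q$ be primes. (1) If $q\not\equiv\pm1 \pmod p$, then up to isomorphism there is a unique group of central type of order $p^2q^2$, namely the abelian group $C_{pq}\times C_{pq}$.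 (2) If $q>3$ and $q\equiv 1$ or $q\equiv -1 \pmod p$, then up to isomorphism there are exactly two groups of central type of order $p^2q^2$; both are semidirect products $(C_q\times C_q)\rtimes(C_p\times C_p)$ in which $C_p\times C_p$ acts through a homomorphism (possibly trivial) to $\mathrm{SL}_2(q)$. (3) Up to isomorphism there are exactly three groups of central type of order $36$ (here $p=2$, $q=3$): the abelian group $C_6\times C_6$, and two non-abelian semidirect products by symplectic actions, $(C_3\times C_3)\rtimes(C_2\times C_2)$ and $(C_2\times C_2)\rtimes(C_3\times C_3)$, where the actions are via homomorphisms to $\mathrm{SL}_2(3)$ and $\mathrm{SL}_2(2)$ respectively. -/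

import Mathlib

/-- A 2-cocycle in `Z²(G, ℂ*)`, where `G` acts trivially on `ℂ*`. -/
structure TwoCocycle (G : Type*) [Group G] where
  toFun : G → G → ℂˣ
  cocycle : ∀ a b c : G, toFun a b * toFun (a * b) c = toFun b c * toFun a (b * c)

instance (G : Type*) [Group G] : CoeFun (TwoCocycle G) (fun _ => G → G → ℂˣ) :=
  ⟨TwoCocycle.toFun⟩

/-- The twisted group algebra `ℂ^f G`: the complex vector space with basis `(u_g)_{g ∈ G}`
and multiplication determined by `u_g * u_h = f(g,h) u_{gh}`. -/
def TwistedGroupAlgebra {G : Type*} [Group G] (_f : TwoCocycle G) : Type _ := G →₀ ℂ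

namespace TwistedGroupAlgebra

noncomputable section

variable {G : Type*} [Group G] (f : TwoCocycle G)

instance : AddCommGroup (TwistedGroupAlgebra f) := inferInstanceAs (AddCommGroup (G →₀ ℂ))

instance : Module ℂ (TwistedGroupAlgebra f) := inferInstanceAs (Module ℂ (G →₀ ℂ))

/-- The standard basis `(u_g)` of `ℂ^f G`. -/
def u : Module.Basis G ℂ (TwistedGroupAlgebra f) := ⟨LinearEquiv.refl ℂ (G →₀ ℂ)⟩

/-- The bilinear multiplication with `u_g * u_h = f(g,h) u_{gh}`. -/
def mulLin : TwistedGroupAlgebra f →ₗ[ℂ] TwistedGroupAlgebra f →ₗ[ℂ] TwistedGroupAlgebra f :=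
  (u f).constr ℂ fun g => (u f).constr ℂ fun h => (f g h : ℂ) • u f (g * h)

theorem mulLin_u (g h : G) : mulLin f (u f g) (u f h) = (f g h : ℂ) • u f (g * h) := by
  simp [mulLin]

theorem one_left (g : G) : f 1 g = f 1 1 := by
  have h := f.cocycle 1 1 g
  simp only [one_mul] at h
  exact (mul_right_cancel h).symm

theorem one_right (g : G) : f g 1 = f 1 1 := by
  have h := f.cocycle g 1 1
  simp only [mul_one] at h
  exact mul_right_cancel h

theorem mulLin_assoc (x y z : TwistedGroupAlgebra f) :
    mulLin f (mulLin f x y) z = mulLin f x (mulLin f y z) := by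
  have h1 : ∀ g h k : G, mulLin f (mulLin f (u f g) (u f h)) (u f k) =
      mulLin f (u f g) (mulLin f (u f h) (u f k)) := by
    intro g h k
    have hc := congrArg (Units.val) (f.cocycle g h k)
    simp only [Units.val_mul] at hc
    simp only [mulLin_u, map_smul, LinearMap.smul_apply, smul_smul, mul_assoc, hc]
  have h2 : ∀ (x : TwistedGroupAlgebra f) (h k : G),
      mulLin f (mulLin f x (u f h)) (u f k) = mulLin f x (mulLin f (u f h) (u f k)) := by
    intro x h k
    have e : (mulLin f).flip (u f k) ∘ₗ (mulLin f).flip (u f h) =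
        (mulLin f).flip (mulLin f (u f h) (u f k)) := (u f).ext fun g => h1 g h k
    exact LinearMap.congr_fun e x
  have h3 : ∀ (x y : TwistedGroupAlgebra f) (k : G),
      mulLin f (mulLin f x y) (u f k) = mulLin f x (mulLin f y (u f k)) := by
    intro x y k
    have e : (mulLin f).flip (u f k) ∘ₗ mulLin f x = mulLin f x ∘ₗ (mulLin f).flip (u f k) :=
      (u f).ext fun h => h2 x h k
    exact LinearMap.congr_fun e y
  have e : mulLin f (mulLin f x y) = mulLin f x ∘ₗ mulLin f y := (u f).ext fun k => h3 x y k
  exact LinearMap.congr_fun e z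

instance : Mul (TwistedGroupAlgebra f) := ⟨fun x y => mulLin f x y⟩

/-- The unit of `ℂ^f G` is `f(1,1)⁻¹ u_1`. -/
instance : One (TwistedGroupAlgebra f) := ⟨((f 1 1 : ℂ)⁻¹) • u f 1⟩

theorem mul_def (x y : TwistedGroupAlgebra f) : x * y = mulLin f x y := rfl

theorem one_def : (1 : TwistedGroupAlgebra f) = ((f 1 1 : ℂ)⁻¹) • u f 1 := rfl

theorem mulLin_one_left (x : TwistedGroupAlgebra f) : mulLin f 1 x = x := by
  have e : mulLin f 1 = LinearMap.id := (u f).ext fun g => by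
    simp [one_def, mulLin_u, one_left, smul_smul]
  exact LinearMap.congr_fun e x

theorem mulLin_one_right (x : TwistedGroupAlgebra f) : mulLin f x 1 = x := by
  have e : (mulLin f).flip 1 = LinearMap.id := (u f).ext fun g => by
    simp [one_def, mulLin_u, one_right, smul_smul]
  exact LinearMap.congr_fun e x

instance : Ring (TwistedGroupAlgebra f) :=
  { (inferInstance : AddCommGroup (TwistedGroupAlgebra f)),
    (inferInstance : Mul (TwistedGroupAlgebra f)),
    (inferInstance : One (TwistedGroupAlgebra f)) with
    left_distrib := fun x y z => (mulLin f x).map_add y z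
    right_distrib := fun x y z => (mulLin f).map_add₂ x y z
    zero_mul := fun x => (mulLin f).map_zero₂ x
    mul_zero := fun x => (mulLin f x).map_zero
    mul_assoc := mulLin_assoc f
    one_mul := mulLin_one_left f
    mul_one := mulLin_one_right f }

instance : Algebra ℂ (TwistedGroupAlgebra f) :=
  Algebra.ofModule (fun r x y => (mulLin f).map_smul₂ r x y) (fun r x y => (mulLin f x).map_smul r y)

theorem u_mul_u (g h : G) : u f g * u f h = (f g h : ℂ) • u f (g * h) := mulLin_u f g h

end

end TwistedGroupAlgebra

/-- `f` is non-degenerate if `ℂ^f G` is a full matrix algebra over `ℂ`. -/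
def TwoCocycle.IsNondegenerate {G : Type*} [Group G] (f : TwoCocycle G) : Prop :=
  ∃ n : ℕ, Nonempty (TwistedGroupAlgebra f ≃ₐ[ℂ] Matrix (Fin n) (Fin n) ℂ)

/-- `f₁` and `f₂` represent the same class in `H²(G, ℂ*)`. -/
def TwoCocycle.Cohomologous {G : Type*} [Group G] (f₁ f₂ : TwoCocycle G) : Prop :=
  ∃ c : G → ℂˣ, ∀ g h : G, f₂ g h = f₁ g h * (c g * c h * (c (g * h))⁻¹)

/-- The action of `Aut(G)` on 2-cocycles: `φ(f)(g,h) = f(φ⁻¹ g, φ⁻¹ h)`. -/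
def TwoCocycle.autAct {G : Type*} [Group G] (φ : MulAut G) (f : TwoCocycle G) : TwoCocycle G where
  toFun g h := f (φ⁻¹ g) (φ⁻¹ h)
  cocycle a b c := by
    simp only [map_mul]
    exact f.cocycle _ _ _

/-- A finite group is of central type if it admits a non-degenerate 2-cocycle. -/
def IsOfCentralType (G : Type*) [Group G] : Prop :=
  Finite G ∧ ∃ f : TwoCocycle G, f.IsNondegenerate

/-- The action `η` of `K` on `N` is symplectic: it fixes some non-degenerate class in
`H²(N, ℂ*)`. -/
def IsSymplecticAction {N K : Type*} [Group N] [Group K] (η : K →* MulAut N) : Prop :=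
  ∃ f : TwoCocycle N, f.IsNondegenerate ∧ ∀ k : K, (f.autAct (η k)).Cohomologous f

/-- The group `C_m × C_m`, realised as `(ℤ/m)²` written multiplicatively. -/
abbrev CyclicSq (m : ℕ) : Type := Multiplicative (Fin 2 → ZMod m)

/-- The natural action of `SL₂(ℤ/m)` on `C_m × C_m = (ℤ/m)²`. -/
def slAction (m : ℕ) :
    Matrix.SpecialLinearGroup (Fin 2) (ZMod m) →* MulAut (CyclicSq m) where
  toFun A := AddEquiv.toMultiplicative (Matrix.SpecialLinearGroup.toLin' A).toAddEquiv
  map_one' := by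
    rw [map_one]
    rfl
  map_mul' A B := by
    rw [map_mul]
    rfl

/-- The semidirect product `(C_m × C_m) ⋊ (C_k × C_k)`, where `C_k × C_k` acts on `C_m × C_m`
through a homomorphism `η` to `SL₂(ℤ/m)`. -/
abbrev SLSemidirect {m k : ℕ}
    (η : CyclicSq k →* Matrix.SpecialLinearGroup (Fin 2) (ZMod m)) : Type :=
  CyclicSq m ⋊[(slAction m).comp η] CyclicSq k

/-! Conjugating by all the `u_h` and summing projects onto the center of the twisted group algebra.
Hence `f` is non-degenerate exactly when no `g ≠ 1` has a lift commuting with the lifts of its whole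
centralizer (`HasNoRegular`). For commuting elements, the commutator of the lifts is an alternating,
conjugation-invariant bicharacter (`pairing`), and it is non-degenerate on every abelian Hall
subgroup. Consequently, in a group of central type of order `p²q²`, both Sylow subgroups are
elementary abelian, and conjugation on a normal one preserves a symplectic form, so it acts through
`SL₂`.

A group of order `p²q²` has a normal Sylow `q`-subgroup, or else `q ∣ p + 1`, which means `p = 2`,
`q = 3`, with a normal Sylow 2-subgroup. So central type forces the shape `SLSemidirect η`.
Conversely every such product is of central type: an invariant bicharacter on the normal factor,
combined with a non-degenerate one on the complement, has no regular elements.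

It remains to count the `η : C_b² → SL₂(a)`. A non-trivial one exists iff `b ∣ a - 1` or `b ∣ a +
1`. Its image is then cyclic of order `b`, and all such subgroups are conjugate in `GL₂(a)`, so
there is one non-abelian group for each choice of normal Sylow subgroup that admits it. -/

namespace TwistedGroupAlgebra

variable {G : Type*} [Group G] (f : TwoCocycle G)

/-! ### Conjugation and central elements in the twisted group algebra. -/

theorem u_mul_inv (g : G) :
    u f g * (((f g g⁻¹ * f 1 1 : ℂˣ) : ℂ)⁻¹ • u f g⁻¹) = 1 := by
  rw [mul_smul_comm, u_mul_u, smul_smul, mul_inv_cancel, one_def]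
  congr 1
  push_cast
  field_simp

theorem inv_mul_u (g : G) :
    (((f g g⁻¹ * f 1 1 : ℂˣ) : ℂ)⁻¹ • u f g⁻¹) * u f g = 1 := by
  have h : f g⁻¹ g = f g g⁻¹ := by
    have := f.cocycle g g⁻¹ g
    rw [mul_inv_cancel, inv_mul_cancel, one_left f g, one_right f g] at this
    exact (mul_right_cancel this).symm
  rw [smul_mul_assoc, u_mul_u, smul_smul, inv_mul_cancel, one_def, h]
  congr 1
  push_cast
  field_simp

/-- The basis element `u_g` as a unit of the twisted group algebra. -/
noncomputable def uUnit (g : G) : (TwistedGroupAlgebra f)ˣ :=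
  ⟨u f g, _, u_mul_inv f g, inv_mul_u f g⟩

@[simp] theorem val_uUnit (g : G) : (uUnit f g : TwistedGroupAlgebra f) = u f g := rfl

theorem uUnit_mul_uUnit (g h : G) :
    uUnit f g * uUnit f h =
      Units.map (algebraMap ℂ (TwistedGroupAlgebra f)).toMonoidHom (f g h) * uUnit f (g * h) := by
  ext
  simp [u_mul_u, Algebra.smul_def]

/-- Conjugation by `u_h`, as a linear endomorphism. -/
noncomputable def conj (h : G) : TwistedGroupAlgebra f →ₗ[ℂ] TwistedGroupAlgebra f :=
  LinearMap.mulRight ℂ (↑(uUnit f h)⁻¹ : TwistedGroupAlgebra f) ∘ₗ LinearMap.mulLeft ℂ (u f h)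

theorem conj_apply (h : G) (x : TwistedGroupAlgebra f) :
    conj f h x = uUnit f h * x * ↑(uUnit f h)⁻¹ := rfl

theorem conj_conj (k h : G) (x : TwistedGroupAlgebra f) :
    conj f k (conj f h x) = conj f (k * h) x := by
  have e : conj f k (conj f h x) =
      ↑(uUnit f k * uUnit f h) * x * ↑(uUnit f k * uUnit f h)⁻¹ := by
    simp [conj_apply, mul_assoc]
  rw [e, uUnit_mul_uUnit, mul_inv_rev, conj_apply]
  simp only [Units.val_mul, Units.coe_map, MonoidHom.coe_coe, RingHom.toMonoidHom_eq_coe,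
    ← map_inv]
  rw [mul_assoc (algebraMap ℂ _ _), mul_assoc (algebraMap ℂ _ _),
    Algebra.commutes, mul_assoc, mul_assoc, mul_assoc, ← map_mul]
  simp [mul_assoc]

theorem conj_mul_u (h : G) (x : TwistedGroupAlgebra f) : conj f h x * u f h = u f h * x := by
  rw [conj_apply, ← val_uUnit, Units.inv_mul_cancel_right]

theorem repr_u_mul (h g : G) (x : TwistedGroupAlgebra f) :
    (u f).repr (u f h * x) (h * g) = f h g * (u f).repr x g := by
  classical
  have e : (u f).coord (h * g) ∘ₗ LinearMap.mulLeft ℂ (u f h) = (f h g : ℂ) • (u f).coord g := by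
    refine (u f).ext fun k => ?_
    by_cases hk : k = g
    · simp [u_mul_u, hk]
    · simp [u_mul_u, hk]
  exact LinearMap.congr_fun e x

theorem repr_mul_u (g h : G) (x : TwistedGroupAlgebra f) :
    (u f).repr (x * u f h) (g * h) = f g h * (u f).repr x g := by
  classical
  have e : (u f).coord (g * h) ∘ₗ LinearMap.mulRight ℂ (u f h) = (f g h : ℂ) • (u f).coord g := by
    refine (u f).ext fun k => ?_
    by_cases hk : k = g
    · simp [u_mul_u, hk]
    · simp [u_mul_u, hk]
  exact LinearMap.congr_fun e x

theorem repr_conj (h g : G) (x : TwistedGroupAlgebra f) :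
    f (h * g * h⁻¹) h * (u f).repr (conj f h x) (h * g * h⁻¹) = f h g * (u f).repr x g := by
  rw [← repr_mul_u, conj_mul_u, inv_mul_cancel_right, repr_u_mul]

theorem repr_conj_one (h : G) (x : TwistedGroupAlgebra f) :
    (u f).repr (conj f h x) 1 = (u f).repr x 1 := by
  have := repr_conj f h 1 x
  rw [mul_one, mul_inv_cancel, one_left f h, one_right f h] at this
  exact mul_left_cancel₀ (Units.ne_zero _) this

/-- The sum of all conjugates `u_h x u_h⁻¹`. -/
noncomputable def conjSum [Fintype G] (x : TwistedGroupAlgebra f) : TwistedGroupAlgebra f :=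
  ∑ h, conj f h x

theorem commute_u_conjSum [Fintype G] (k : G) (x : TwistedGroupAlgebra f) :
    u f k * conjSum f x = conjSum f x * u f k := by
  rw [← conj_mul_u, conjSum, map_sum]
  simp only [conj_conj]
  rw [Fintype.sum_equiv (Equiv.mulLeft k) (fun h => conj f (k * h) x) (fun h => conj f h x)
    fun _ => rfl]

theorem conjSum_mem_center [Fintype G] (x : TwistedGroupAlgebra f) :
    conjSum f x ∈ Subalgebra.center ℂ (TwistedGroupAlgebra f) := by
  rw [Subalgebra.mem_center_iff]
  intro b
  have e : LinearMap.mulRight ℂ (conjSum f x) = LinearMap.mulLeft ℂ (conjSum f x) :=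
    (u f).ext fun k => commute_u_conjSum f k x
  exact LinearMap.congr_fun e b

theorem repr_conjSum_one [Fintype G] (x : TwistedGroupAlgebra f) :
    (u f).repr (conjSum f x) 1 = Fintype.card G * (u f).repr x 1 := by
  simp [conjSum, map_sum, repr_conj_one]

/-- Only the `h` centralizing `g` contribute to this coefficient, and regularity makes each
contribute 1; the value is the order of the centralizer. -/
theorem repr_conjSum_of_regular [Fintype G] (g : G)
    (hg : ∀ h, Commute g h → f g h = f h g) : (u f).repr (conjSum f (u f g)) g ≠ 0 := by
  classical
  have e : ∀ h, (u f).repr (conj f h (u f g)) g = if Commute g h then 1 else 0 := by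
    intro h
    split_ifs with hc
    · have := repr_conj f h g (u f g)
      rw [← hc.eq, mul_inv_cancel_right, hg h hc] at this
      simpa using mul_left_cancel₀ (Units.ne_zero _) this
    · have := repr_conj f h (h⁻¹ * g * h) (u f g)
      have e1 : h * (h⁻¹ * g * h) * h⁻¹ = g := by group
      have e2 : g ≠ h⁻¹ * g * h := fun e2 => hc <| by
        rw [mul_assoc, eq_inv_mul_iff_mul_eq] at e2
        exact e2.symm
      rw [e1, Module.Basis.repr_self, Finsupp.single_eq_of_ne e2.symm, mul_zero] at this
      exact (mul_eq_zero.mp this).resolve_left (Units.ne_zero _)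
  rw [conjSum, map_sum, Finsupp.finsetSum_apply, Finset.sum_congr rfl fun h _ => e h,
    Finset.sum_boole, Nat.cast_ne_zero]
  exact (Finset.card_pos.mpr ⟨1, by simp⟩).ne'

instance [Nonempty G] : Nontrivial (TwistedGroupAlgebra f) :=
  inferInstanceAs (Nontrivial (G →₀ ℂ))

instance [Finite G] : FiniteDimensional ℂ (TwistedGroupAlgebra f) := Module.Finite.of_basis (u f)

end TwistedGroupAlgebra

/-! ### Non-degeneracy as absence of regular elements. -/

namespace TwoCocycle

open TwistedGroupAlgebra

variable {G : Type*} [Group G] {f : TwoCocycle G}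

/-- Every nontrivial element `g` has a commuting partner `h` such that the lifts `u_g`, `u_h`
do not commute. -/
def HasNoRegular (f : TwoCocycle G) : Prop :=
  ∀ g : G, g ≠ 1 → ∃ h, Commute g h ∧ f g h ≠ f h g

/-- A regular `g ≠ 1` would give a central element with non-zero coefficient at `g`, while the
center of a matrix algebra consists of scalars. -/
theorem IsNondegenerate.hasNoRegular [Finite G] (hf : f.IsNondegenerate) : f.HasNoRegular := by
  have := Fintype.ofFinite G
  obtain ⟨n, ⟨e⟩⟩ := hf
  intro g hg
  by_contra! hreg
  have hc := conjSum_mem_center f (u f g)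
  have hm : e (conjSum f (u f g)) ∈ Subalgebra.center ℂ (Matrix (Fin n) (Fin n) ℂ) := by
    rw [Subalgebra.mem_center_iff] at hc ⊢
    intro b
    obtain ⟨b, rfl⟩ := e.surjective b
    rw [← map_mul, hc, map_mul]
  rw [Algebra.IsCentral.center_eq_bot, Algebra.mem_bot] at hm
  obtain ⟨c, hc⟩ := hm
  have hz : conjSum f (u f g) = c • 1 := by
    apply e.injective
    rw [← hc, map_smul, map_one, Algebra.algebraMap_eq_smul_one]
  refine repr_conjSum_of_regular f g hreg ?_
  rw [hz, one_def]
  simp [Finsupp.single_eq_of_ne hg]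

/-- The algebra is simple: a non-zero element of an ideal, translated to have a coefficient at 1 and
then summed over conjugates, becomes a non-zero scalar. Wedderburn over `ℂ` concludes. -/
theorem HasNoRegular.isNondegenerate [Finite G] (hf : f.HasNoRegular) : f.IsNondegenerate := by
  have := Fintype.ofFinite G
  have hsimple : IsSimpleRing (TwistedGroupAlgebra f) := by
    refine ⟨⟨fun I => or_iff_not_imp_left.mpr fun hI => ?_⟩⟩
    obtain ⟨x, hxI, hx⟩ : ∃ x ∈ I, x ≠ 0 := by
      by_contra! h
      exact hI (eq_bot_iff.mpr fun x hx => (TwoSidedIdeal.mem_bot _).mpr (h x hx))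
    obtain ⟨g, hg⟩ : ∃ g, (u f).repr x g ≠ 0 := by
      by_contra! h
      exact hx ((u f).repr.map_eq_zero_iff.mp (Finsupp.ext h))
    set y := u f g⁻¹ * x with hy
    have hyI : y ∈ I := I.mul_mem_left _ _ hxI
    have hy1 : (u f).repr y 1 ≠ 0 := by
      rw [hy, ← inv_mul_cancel g, repr_u_mul]
      exact mul_ne_zero (Units.ne_zero _) hg
    have hzI : conjSum f y ∈ I :=
      sum_mem fun h _ => by
        rw [conj_apply]
        exact I.mul_mem_right _ _ (I.mul_mem_left _ _ hyI)
    -- A central element commutes with `u_h`; comparing coefficients at `h * k` for the partner `h`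
    -- of `k` kills its coefficient at `k ≠ 1`.
    have hz : conjSum f y = (u f).repr (conjSum f y) 1 • u f 1 := by
      apply (u f).repr.injective
      ext k
      by_cases hk : k = 1
      · simp [hk]
      · obtain ⟨h, hc, hne⟩ := hf k hk
        have h1 := repr_u_mul f h k (conjSum f y)
        rw [commute_u_conjSum, ← hc.eq, repr_mul_u] at h1
        rw [map_smul, Module.Basis.repr_self, Finsupp.smul_apply, Finsupp.single_eq_of_ne hk,
          smul_zero]
        by_contra h0
        exact hne (Units.ext (mul_right_cancel₀ h0 h1))
    have hc : (u f).repr (conjSum f y) 1 ≠ 0 := by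
      rw [repr_conjSum_one]
      exact mul_ne_zero (Nat.cast_ne_zero.mpr Fintype.card_ne_zero) hy1
    rw [← TwoSidedIdeal.one_mem_iff]
    have : (1 : TwistedGroupAlgebra f) =
        ((f 1 1 : ℂ)⁻¹ * ((u f).repr (conjSum f y) 1)⁻¹) • (1 * conjSum f y) := by
      rw [one_mul]
      conv_rhs => rw [hz]
      rw [smul_smul, mul_assoc, map_smul]
      simp [one_def, hc]
    rw [this, ← smul_mul_assoc]
    exact I.mul_mem_left _ _ hzI
  obtain ⟨n, -, ⟨e⟩⟩ := IsSimpleRing.exists_algEquiv_matrix_of_isAlgClosed ℂ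
    (TwistedGroupAlgebra f)
  exact ⟨n, ⟨e⟩⟩

/-- Pull-back of a cocycle along a homomorphism. -/
def comap {H : Type*} [Group H] (f : TwoCocycle G) (φ : H →* G) : TwoCocycle H where
  toFun a b := f (φ a) (φ b)
  cocycle a b c := by
    simp only [map_mul]
    exact f.cocycle _ _ _

theorem HasNoRegular.comap_equiv {H : Type*} [Group H] (hf : f.HasNoRegular) (φ : H ≃* G) :
    (f.comap φ.toMonoidHom).HasNoRegular := by
  intro h hh
  obtain ⟨k, hk, hne⟩ := hf (φ h) (by simpa using hh)
  refine ⟨φ.symm k, ?_, by simpa [comap] using hne⟩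
  have := hk.map φ.symm
  simpa using this

end TwoCocycle

theorem isOfCentralType_iff {G : Type*} [Group G] :
    IsOfCentralType G ↔ Finite G ∧ ∃ f : TwoCocycle G, f.HasNoRegular :=
  ⟨fun ⟨h, f, hf⟩ => ⟨h, f, hf.hasNoRegular⟩, fun ⟨h, f, hf⟩ => ⟨h, f, hf.isNondegenerate⟩⟩

theorem IsOfCentralType.of_mulEquiv {G H : Type*} [Group G] [Group H]
    (hG : IsOfCentralType G) (φ : H ≃* G) : IsOfCentralType H := by
  rw [isOfCentralType_iff] at hG ⊢
  obtain ⟨_, f, hf⟩ := hG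
  exact ⟨Finite.of_equiv G φ.symm.toEquiv, _, hf.comap_equiv φ⟩

theorem pow_natCard_eq_one_of_mem {G : Type*} [Group G] {Q : Subgroup G} {g : G} (hg : g ∈ Q) :
    g ^ Nat.card Q = 1 :=
  congrArg Subtype.val (pow_card_eq_one' (x := (⟨g, hg⟩ : Q)))

/-! ### The commutator pairing. -/

namespace TwistedGroupAlgebra

variable {G : Type*} [Group G] (f : TwoCocycle G)

protected theorem conj_mul (k : G) (x y : TwistedGroupAlgebra f) :
    conj f k (x * y) = conj f k x * conj f k y := by
  simp only [conj_apply, mul_assoc, Units.inv_mul_cancel_left]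

theorem conj_u (k g : G) :
    conj f k (u f g) = ((f k g : ℂ) * (f (k * g * k⁻¹) k : ℂ)⁻¹) • u f (k * g * k⁻¹) := by
  apply (uUnit f k).isUnit.mul_right_cancel
  rw [val_uUnit]
  rw [conj_mul_u, u_mul_u, smul_mul_assoc, u_mul_u, smul_smul, inv_mul_cancel_right]
  simp

end TwistedGroupAlgebra

namespace TwoCocycle

open TwistedGroupAlgebra

section Pairing

variable {G : Type*} [Group G] (f : TwoCocycle G)

/-- The commutator of the lifts `u_g` and `u_h`, meaningful when `g` and `h` commute. -/
noncomputable def pairing (g h : G) : ℂˣ := f g h / f h g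

variable {f} {g h k : G}

theorem pairing_ne_one_iff : f.pairing g h ≠ 1 ↔ f g h ≠ f h g := by
  simp [pairing, div_eq_one]

@[simp] theorem pairing_self : f.pairing g g = 1 := div_self' _

theorem inv_pairing : (f.pairing g h)⁻¹ = f.pairing h g := inv_div _ _

@[simp] theorem pairing_one_right : f.pairing g 1 = 1 := by
  rw [pairing, one_left f g, one_right f g, div_self']

theorem pairing_mul_right (hh : Commute g h) (hk : Commute g k) :
    f.pairing g (h * k) = f.pairing g h * f.pairing g k := by
  have h1 := f.cocycle g h k
  have h2 := f.cocycle h g k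
  have h3 := f.cocycle h k g
  rw [← hh.eq, hk.eq] at h2
  simp only [pairing, Units.ext_iff, Units.val_mul, Units.val_div_eq_div_val] at h1 h2 h3 ⊢
  have e : ∀ a b, (f a b : ℂ) ≠ 0 := fun a b => Units.ne_zero _
  rw [div_mul_div_comm, div_eq_div_iff (e _ _) (mul_ne_zero (e _ _) (e _ _))]
  apply mul_left_cancel₀ (e h k)
  apply mul_left_cancel₀ (e h (k * g))
  linear_combination (-(f h (k * g) : ℂ) * f h g * f k g) * h1 +
 -
    (f g h : ℂ) * f g k * f h (k * g) * h3 +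
    (f g h : ℂ) * f k g * f h (k * g) * h2

theorem pairing_mul_left (hg : Commute g k) (hh : Commute h k) :
    f.pairing (g * h) k = f.pairing g k * f.pairing h k := by
  rw [← inv_pairing, pairing_mul_right hg.symm hh.symm, mul_inv, inv_pairing, inv_pairing]

theorem pairing_pow_right (hh : Commute g h) (n : ℕ) :
    f.pairing g (h ^ n) = f.pairing g h ^ n := by
  induction n with
  | zero => simp
  | succ n ih => rw [pow_succ, pairing_mul_right (hh.pow_right n) hh, ih, pow_succ]

theorem pairing_pow_left (hh : Commute g h) (n : ℕ) :
    f.pairing (g ^ n) h = f.pairing g h ^ n := by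
  rw [← inv_pairing, pairing_pow_right hh.symm, ← inv_pow, inv_pairing]

/-- Conjugation by `u_k` is multiplicative and rescales basis vectors, so it preserves the ratio of
`u_g u_h` to `u_h u_g`; the rescaling factors are the same on both sides and cancel. -/
theorem pairing_conj (hh : Commute g h) :
    f.pairing (k * g * k⁻¹) (k * h * k⁻¹) = f.pairing g h := by
  have key : ∀ a b : G, conj f k (u f a * u f b) =
      ((f k a : ℂ) * (f (k * a * k⁻¹) k : ℂ)⁻¹ * (f k b * (f (k * b * k⁻¹) k : ℂ)⁻¹) *
        f (k * a * k⁻¹) (k * b * k⁻¹)) • u f (k * (a * b) * k⁻¹) := by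
    intro a b
    rw [TwistedGroupAlgebra.conj_mul, conj_u, conj_u, smul_mul_smul_comm, u_mul_u, smul_smul]
    group
  have h1 := key g h
  have h2 := key h g
  rw [u_mul_u, map_smul] at h1 h2
  rw [← hh.eq] at h2
  have h3 : (f h g : ℂ) • ((f g h : ℂ) • conj f k (u f (g * h))) =
      (f g h : ℂ) • ((f h g : ℂ) • conj f k (u f (g * h))) := smul_comm _ _ _
  rw [h1, h2, smul_smul, smul_smul] at h3
  have h4 := congrArg (fun x => (u f).repr x (k * (g * h) * k⁻¹)) h3
  simp only [map_smul, Module.Basis.repr_self, Finsupp.smul_apply, Finsupp.single_eq_same,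
    smul_eq_mul, mul_one] at h4
  have e : ∀ a b, (f a b : ℂ) ≠ 0 := fun a b => Units.ne_zero _
  simp only [pairing, Units.ext_iff, Units.val_div_eq_div_val]
  rw [div_eq_div_iff (e _ _) (e _ _)]
  have h5 : (f k g : ℂ) * (f (k * g * k⁻¹) k : ℂ)⁻¹ * (f k h * (f (k * h * k⁻¹) k : ℂ)⁻¹) ≠ 0 := by
    simp [e]
  apply mul_left_cancel₀ h5
  linear_combination h4

/-- Otherwise pairing with `g` is a character of the centralizer of `g` that is trivial on `Q`. Its
values have order dividing both `Q.index` and, since `g ∈ Q`, the order of `Q`; by coprimality the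
character is trivial and `g` is regular. -/
theorem HasNoRegular.exists_pairing_ne_one_of_hall (hf : f.HasNoRegular) {Q : Subgroup G}
    [IsMulCommutative Q] (hQ : (Nat.card Q).Coprime Q.index) (hg : g ∈ Q) (hg1 : g ≠ 1) :
    ∃ h ∈ Q, f.pairing g h ≠ 1 := by
  by_contra! hQ1
  obtain ⟨h, hc, hne⟩ := hf g hg1
  rw [← pairing_ne_one_iff] at hne
  have hcomm : ∀ x ∈ Subgroup.centralizer {g}, Commute g x := fun x hx =>
    (Subgroup.mem_centralizer_singleton_iff.mp hx).symm
  let χ : Subgroup.centralizer {g} →* ℂˣ :=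
    { toFun := fun x => f.pairing g x
      map_one' := by simp
      map_mul' := fun x y => pairing_mul_right (hcomm x x.2) (hcomm y y.2) }
  have hle : Q ≤ Subgroup.centralizer {g} := fun x hx =>
    Subgroup.mem_centralizer_singleton_iff.mpr (setLike_mul_comm hx hg)
  have hker : Q.subgroupOf (Subgroup.centralizer {g}) ≤ χ.ker := fun x hx => hQ1 x hx
  have hdvd : χ.ker.index ∣ Q.index :=
    (Subgroup.index_dvd_of_le hker).trans (Subgroup.relIndex_dvd_index_of_le hle)
  have hpow : f.pairing g h ^ Q.index = 1 := by
    have := Subgroup.pow_index_mem χ.ker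
      ⟨h, Subgroup.mem_centralizer_singleton_iff.mpr hc.symm⟩
    have h2 : f.pairing g h ^ χ.ker.index = 1 := by
      rw [← pairing_pow_right hc]
      exact this
    obtain ⟨m, hm⟩ := hdvd
    rw [hm, pow_mul, h2, one_pow]
  have hpow2 : f.pairing g h ^ Nat.card Q = 1 := by
    rw [← pairing_pow_left hc, pow_natCard_eq_one_of_mem hg]
    rw [← inv_pairing]
    simp
  exact hne ((pow_eq_one_iff_of_coprime hQ).mp ⟨hpow2, hpow⟩)

end Pairing

end TwoCocycle

/-! ### Elementary abelian Sylow subgroups and actions through `SL₂`. -/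

theorem nonempty_mulEquiv_cyclicSq {Q : Type*} [Group Q] {a : ℕ} [Fact a.Prime]
    (hcard : Nat.card Q = a ^ 2) (hexp : ∀ g : Q, g ^ a = 1) : Nonempty (Q ≃* CyclicSq a) := by
  let := IsPGroup.commGroupOfCardEqPrimeSq hcard
  let : Module (ZMod a) (Additive Q) := AddCommGroup.zmodModule (n := a) fun x => hexp x.toMul
  have hfin : Finite Q := Nat.finite_of_card_ne_zero (by
    rw [hcard]
    exact pow_ne_zero _ (Fact.out : a.Prime).ne_zero)
  have : Finite (Additive Q) := hfin
  have h1 : Module.finrank (ZMod a) (Additive Q) = 2 := by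
    have := Module.natCard_eq_pow_finrank (K := ZMod a) (V := Additive Q)
    rw [Nat.card_zmod, Nat.card_congr Additive.toMul, hcard] at this
    exact (Nat.pow_right_injective (Fact.out : a.Prime).two_le this).symm
  have e : Additive Q ≃ₗ[ZMod a] (Fin 2 → ZMod a) :=
    LinearEquiv.ofFinrankEq _ _ (by simp [h1])
  exact ⟨AddEquiv.toMultiplicativeRight e.toAddEquiv⟩

/-- Otherwise `g` generates `Q`, and an alternating pairing vanishes on a cyclic group. -/
theorem TwoCocycle.HasNoRegular.pow_prime_eq_one {G : Type*} [Group G] {f : TwoCocycle G}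
    (hf : f.HasNoRegular) {a : ℕ} [Fact a.Prime] {Q : Subgroup G} (hcard : Nat.card Q = a ^ 2)
    (hQ : (Nat.card Q).Coprime Q.index) {g : G} (hg : g ∈ Q) : g ^ a = 1 := by
  have hfin : Finite Q := Nat.finite_of_card_ne_zero (by
    rw [hcard]
    exact pow_ne_zero _ (Fact.out : a.Prime).ne_zero)
  have := IsPGroup.isMulCommutative_of_card_eq_prime_sq hcard
  by_contra hga
  have hord : orderOf g = a ^ 2 := by
    refine orderOf_eq_prime_pow (n := 1) (by simpa using hga) ?_
    rw [← pow_natCard_eq_one_of_mem hg, hcard]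
  have hz : Subgroup.zpowers g = Q := by
    apply Subgroup.eq_of_le_of_card_ge (by simpa using hg)
    rw [Nat.card_zpowers, hord, hcard]
  have hg1 : g ≠ 1 := fun h => hga (by simp [h])
  obtain ⟨h, hh, hne⟩ := hf.exists_pairing_ne_one_of_hall hQ hg hg1
  have hfo : IsOfFinOrder g := orderOf_pos_iff.mp (by
    rw [hord]
    exact pow_pos (Fact.out : a.Prime).pos _)
  rw [← hz, ← hfo.mem_powers_iff_mem_zpowers] at hh
  obtain ⟨n, rfl⟩ := hh
  exact hne (by rw [TwoCocycle.pairing_pow_right (Commute.refl g)]; simp)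

namespace CyclicSq

variable {a : ℕ}

/-- The standard basis of `C_a × C_a`. -/
def e (i : Fin 2) : CyclicSq a := Multiplicative.ofAdd (Pi.single i 1)

theorem eq_e_pow [NeZero a] (x : CyclicSq a) :
    x = e 0 ^ (x.toAdd 0).val * e 1 ^ (x.toAdd 1).val := by
  apply Multiplicative.toAdd.injective
  ext i
  fin_cases i <;> simp [e, -ZMod.natCast_val, ZMod.natCast_zmod_val]

theorem hom_ext [NeZero a] {M : Type*} [Monoid M] {φ ψ : CyclicSq a →* M}
    (h : ∀ i, φ (e i) = ψ (e i)) : φ = ψ := by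
  refine MonoidHom.ext fun x => ?_
  rw [eq_e_pow x]
  simp only [map_mul, map_pow, h]

theorem mulAut_ext [NeZero a] {φ ψ : MulAut (CyclicSq a)} (h : ∀ i, φ (e i) = ψ (e i)) :
    φ = ψ :=
  MulEquiv.toMonoidHom_injective (hom_ext h)

theorem slAction_apply (A : Matrix.SpecialLinearGroup (Fin 2) (ZMod a)) (x : CyclicSq a) :
    slAction a A x = Multiplicative.ofAdd (A.1.mulVec x.toAdd) := rfl

theorem slAction_injective : Function.Injective (slAction a) := by
  intro A B h
  ext i j
  have := congrFun (congrArg Multiplicative.toAdd (DFunLike.congr_fun h (e j))) i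
  simpa [slAction_apply, e] using this

theorem pow_eq_one (x : CyclicSq a) : x ^ a = 1 := by
  apply Multiplicative.toAdd.injective
  ext i
  simp

theorem natCard : Nat.card (CyclicSq a) = a ^ 2 := by
  rw [Nat.card_congr Multiplicative.toAdd]
  simp [Nat.card_fun]

/-- With `ζ = B (e 0) (e 1)`, of order `a`, one has `B (φ (e 0)) (φ (e 1)) = ζ ^ det φ`; invariance
forces determinant 1. -/
theorem exists_slAction_eq [Fact a.Prime] {B : CyclicSq a → CyclicSq a → ℂˣ}
    (hl : ∀ x x' y, B (x * x') y = B x y * B x' y) (hr : ∀ x y y', B x (y * y') = B x y * B x y')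
    (hself : ∀ x, B x x = 1) (hnd : ∀ x, x ≠ 1 → ∃ y, B x y ≠ 1) (φ : MulAut (CyclicSq a))
    (hφ : ∀ x y, B (φ x) (φ y) = B x y) : ∃ A, slAction a A = φ := by
  have hp : a.Prime := Fact.out
  have h1l : ∀ y, B 1 y = 1 := fun y => by simpa using hl 1 1 y
  have h1r : ∀ x, B x 1 = 1 := fun x => by simpa using hr x 1 1
  have hpl : ∀ x y (n : ℕ), B (x ^ n) y = B x y ^ n := fun x y n => by
    induction n with
    | zero => simp [h1l]
    | succ n ih => rw [pow_succ, hl, ih, pow_succ]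
  have hpr : ∀ x y (n : ℕ), B x (y ^ n) = B x y ^ n := fun x y n => by
    induction n with
    | zero => simp [h1r]
    | succ n ih => rw [pow_succ, hr, ih, pow_succ]
  have hskew : B (e 1) (e 0) = (B (e 0) (e 1))⁻¹ := by
    have := hself (e 0 * e 1)
    rw [hl, hr, hr, hself, hself, one_mul, mul_one] at this
    exact eq_inv_of_mul_eq_one_right this
  have he0 : (e 0 : CyclicSq a) ≠ 1 := fun h => by
    have := congrFun (congrArg Multiplicative.toAdd h) 0
    simp [e] at this
  have hζ : B (e 0) (e 1) ≠ 1 := by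
    intro h
    obtain ⟨y, hy⟩ := hnd (e 0) he0
    rw [eq_e_pow y, hr, hpr, hpr, hself, h] at hy
    simp at hy
  have hord : orderOf (B (e 0) (e 1)) = a :=
    orderOf_eq_prime (by rw [← hpl, pow_eq_one, h1l]) hζ
  set i := (φ (e 0)).toAdd 0 with hi
  set j := (φ (e 0)).toAdd 1 with hj
  set k := (φ (e 1)).toAdd 0 with hk
  set l := (φ (e 1)).toAdd 1 with hl'
  have hdet : i * l - k * j = 1 := by
    have h := hφ (e 0) (e 1)
    rw [eq_e_pow (φ (e 0)), eq_e_pow (φ (e 1)), ← hi, ← hj, ← hk, ← hl'] at h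
    simp only [hl, hr, hpl, hpr, hself, hskew, one_pow, one_mul, mul_one, inv_pow,
      ← pow_mul] at h
    rw [mul_inv_eq_iff_eq_mul, ← pow_succ', pow_eq_pow_iff_modEq, hord,
      ← ZMod.natCast_eq_natCast_iff] at h
    push_cast [ZMod.natCast_zmod_val] at h
    linear_combination h
  let A : Matrix.SpecialLinearGroup (Fin 2) (ZMod a) :=
    ⟨!![i, k; j, l], by rw [Matrix.det_fin_two_of, hdet]⟩
  refine ⟨A, ?_⟩
  refine mulAut_ext fun m => ?_
  rw [slAction_apply]
  apply Multiplicative.toAdd.injective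
  ext n
  fin_cases m <;> fin_cases n <;>
    simp [A, i, j, k, l, e]

end CyclicSq

-- A Sylow `b`-subgroup complements `N`, and its conjugation action preserves the non-degenerate
-- pairing on `N`.
open Subgroup in
theorem TwoCocycle.HasNoRegular.exists_slSemidirect {G : Type*} [Group G] {f : TwoCocycle G}
    (hf : f.HasNoRegular) {a b : ℕ} [Fact a.Prime] [Fact b.Prime] (hab : a ≠ b)
    (hcard : Nat.card G = a ^ 2 * b ^ 2) (N : Subgroup G) [N.Normal]
    (hN : Nat.card N = a ^ 2) :
    ∃ η : CyclicSq b →* Matrix.SpecialLinearGroup (Fin 2) (ZMod a),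
      Nonempty (G ≃* SLSemidirect η) := by
  have ha : a.Prime := Fact.out
  have hb : b.Prime := Fact.out
  have : Finite G := Nat.finite_of_card_ne_zero (by
    rw [hcard]
    exact mul_ne_zero (pow_ne_zero _ ha.ne_zero) (pow_ne_zero _ hb.ne_zero))
  have hco : (a ^ 2).Coprime (b ^ 2) := Nat.Coprime.pow _ _ ((Nat.coprime_primes ha hb).mpr hab)
  obtain ⟨K, hK⟩ := Sylow.exists_subgroup_card_pow_prime (G := G) b (n := 2)
    (by rw [hcard]; exact dvd_mul_left _ _)
  have hcomp : N.IsComplement' K :=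
    isComplement'_of_coprime (by rw [hN, hK, hcard]) (by rwa [hN, hK])
  have hNco : (Nat.card N).Coprime N.index := by
    rwa [hcomp.symm.index_eq_card, hN, hK]
  have hKco : (Nat.card K).Coprime K.index := by
    rw [hcomp.index_eq_card, hN, hK]
    exact hco.symm
  have := IsPGroup.isMulCommutative_of_card_eq_prime_sq hN
  obtain ⟨eN⟩ := nonempty_mulEquiv_cyclicSq hN fun g =>
    Subtype.ext (hf.pow_prime_eq_one hN hNco g.2)
  obtain ⟨eK⟩ := nonempty_mulEquiv_cyclicSq hK fun g =>
    Subtype.ext (hf.pow_prime_eq_one hK hKco g.2)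
  let B : CyclicSq a → CyclicSq a → ℂˣ := fun x y => f.pairing (eN.symm x) (eN.symm y)
  have hcomm : ∀ x y : N, Commute (x : G) y := fun x y => setLike_mul_comm x.2 y.2
  let ψ : CyclicSq b →* MulAut (CyclicSq a) := MonoidHom.comp (MulAut.congr eN).toMonoidHom
    (((N.normalizerMonoidHom).comp (inclusion (N.normalizer_eq_top ▸ le_top))).comp
      eK.symm.toMonoidHom)
  have hψ : ∀ k, ψ k ∈ (slAction a).range := by
    intro k
    refine CyclicSq.exists_slAction_eq (B := B) ?_ ?_ ?_ ?_ (ψ k) ?_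
    · intro x x' y
      simp only [B, map_mul, coe_mul]
      exact TwoCocycle.pairing_mul_left (hcomm _ _) (hcomm _ _)
    · intro x x' y
      simp only [B, map_mul, coe_mul]
      exact TwoCocycle.pairing_mul_right (hcomm _ _) (hcomm _ _)
    · intro x
      simp [B]
    · intro x hx
      obtain ⟨y, hy, hne⟩ := hf.exists_pairing_ne_one_of_hall hNco (eN.symm x).2
        (by simpa using hx)
      exact ⟨eN ⟨y, hy⟩, by simpa [B] using hne⟩
    · intro x y
      have e : ∀ x, (eN.symm (ψ k x) : G) = (eK.symm k : G) * eN.symm x * (eK.symm k : G)⁻¹ := by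
        intro x
        simp [ψ]
      simp only [B, e]
      exact TwoCocycle.pairing_conj (hcomm _ _)
  -- `slAction` is injective, so the action lifts to a homomorphism into `SL₂`.
  let η : CyclicSq b →* Matrix.SpecialLinearGroup (Fin 2) (ZMod a) :=
    (MonoidHom.ofInjective CyclicSq.slAction_injective).symm.toMonoidHom.comp
      (ψ.codRestrict (slAction a).range hψ)
  have hη : (slAction a).comp η = ψ := by
    refine MonoidHom.ext fun k => ?_
    exact congrArg Subtype.val
      ((MonoidHom.ofInjective CyclicSq.slAction_injective).apply_symm_apply ⟨ψ k, hψ k⟩)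
  refine ⟨η, ⟨(SemidirectProduct.mulEquivSubgroup hcomp).symm.trans
    (SemidirectProduct.congr eN eK fun k => ?_)⟩⟩
  rw [hη]
  ext x
  simp [ψ]

/-! ### A normal Sylow subgroup. -/

open Subgroup in
/-- A group of order `p²q²` with `p < q` has a normal Sylow subgroup. -/
theorem exists_normal_of_card_eq {G : Type*} [Group G] {p q : ℕ} [Fact p.Prime] [Fact q.Prime]
    (hpq : p < q) (hcard : Nat.card G = p ^ 2 * q ^ 2) :
    (∃ N : Subgroup G, N.Normal ∧ Nat.card N = q ^ 2) ∨
      (q ∣ p + 1 ∧ ∃ N : Subgroup G, N.Normal ∧ Nat.card N = p ^ 2) := by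
  have hp : p.Prime := Fact.out
  have hq : q.Prime := Fact.out
  have : Finite G := Nat.finite_of_card_ne_zero (by
    rw [hcard]
    exact mul_ne_zero (pow_ne_zero _ hp.ne_zero) (pow_ne_zero _ hq.ne_zero))
  have hco : (p ^ 2).Coprime (q ^ 2) :=
    Nat.Coprime.pow _ _ ((Nat.coprime_primes hp hq).mpr hpq.ne)
  let Q : Sylow q G := default
  have hQ : Nat.card Q = q ^ 2 := by
    rw [Q.card_eq_multiplicity, hcard, Nat.factorization_mul (pow_ne_zero _ hp.ne_zero)
      (pow_ne_zero _ hq.ne_zero), hp.factorization_pow, hq.factorization_pow]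
    simp [hpq.ne]
  have hindex : (Q : Subgroup G).index = p ^ 2 := by
    have := (Q : Subgroup G).card_mul_index
    rw [hcard, mul_comm (p ^ 2), hQ] at this
    exact Nat.eq_of_mul_eq_mul_left (pow_pos hq.pos 2) this
  -- The number of Sylow `q`-subgroups is `p ^ m` with `m ≤ 2` and is 1 modulo `q`; `m = 1` would
  -- give `q ∣ p - 1`, impossible as `p < q`.
  have hdvd := Q.card_dvd_index
  rw [hindex, Nat.dvd_prime_pow hp] at hdvd
  obtain ⟨m, hm, hn⟩ := hdvd
  have hmod := card_sylow_modEq_one q G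
  rw [hn] at hmod
  have hdiv := (Nat.modEq_iff_dvd' (Nat.one_le_pow _ _ hp.pos)).mp hmod.symm
  interval_cases m
  · left
    refine ⟨Q, ?_, hQ⟩
    exact normalizer_eq_top_iff.mp (index_eq_one.mp
      (Q.card_eq_index_normalizer.symm.trans (hn.trans (pow_zero _))))
  · rw [pow_one] at hdiv
    have := Nat.le_of_dvd (Nat.sub_pos_of_lt hp.one_lt) hdiv
    omega
  · right
    constructor
    · have e : p ^ 2 - 1 = (p + 1) * (p - 1) := by
        rw [← Nat.sq_sub_sq p 1, one_pow]
      rw [e] at hdiv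
      refine (hq.dvd_mul.mp hdiv).resolve_right fun h => ?_
      have := Nat.le_of_dvd (Nat.sub_pos_of_lt hp.one_lt) h
      omega
    -- With `p²` conjugates the abelian group `Q` is its own normalizer, so Burnside's transfer
    -- theorem yields a normal complement.
    · have := IsPGroup.isMulCommutative_of_card_eq_prime_sq hQ
      have hle : (Q : Subgroup G) = normalizer (Q : Set G) := by
        refine eq_of_le_of_card_ge le_normalizer (le_of_eq ?_)
        have h1 := (normalizer (Q : Set G)).card_mul_index
        have h2 := (Q : Subgroup G).card_mul_index
        rw [← Q.card_eq_index_normalizer, hn, ← h2, hindex] at h1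
        exact Nat.eq_of_mul_eq_mul_right (pow_pos hp.pos 2) h1
      have hP : normalizer (Q : Set G) ≤ centralizer (Q : Set G) := by
        rw [← hle]
        exact le_centralizer (Q : Subgroup G)
      have hcomp := MonoidHom.ker_transferSylow_isComplement' Q hP
      exact ⟨_, MonoidHom.normal_ker _, hcomp.index_eq_card.symm.trans hindex⟩

/-! ### Fixed vectors of elements of `SL₂` of order prime to the characteristic. -/

namespace Matrix

variable {F : Type*} [Field F] {C : Matrix (Fin 2) (Fin 2) F} {b : ℕ}

/-- By Cayley–Hamilton `(C - 1)² = 0`, so `C ^ b = 1 + b • (C - 1)`, and `b` is invertible. -/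
theorem eq_one_of_trace_eq_two (hdet : C.det = 1) (htr : C.trace = 2) (hpow : C ^ b = 1)
    (hb : (b : F) ≠ 0) : C = 1 := by
  have hsq : (C - 1) * (C - 1) = 0 := by
    rw [det_fin_two] at hdet
    rw [trace_fin_two] at htr
    ext i j
    fin_cases i <;> fin_cases j <;> simp [mul_apply, Fin.sum_univ_two]
    · linear_combination C 0 0 * htr - hdet
    · linear_combination C 0 1 * htr
    · linear_combination C 1 0 * htr
    · linear_combination C 1 1 * htr - hdet
  have hn : ∀ n : ℕ, C ^ n = 1 + n • (C - 1) := by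
    intro n
    induction n with
    | zero => simp
    | succ n ih =>
      have e : C = 1 + (C - 1) := by abel
      rw [pow_succ, ih]
      nth_rw 2 [e]
      rw [mul_add, mul_one, add_mul, one_mul, smul_mul_assoc, hsq, smul_zero, add_zero, add_smul,
        one_smul, add_assoc]
  have h := hn b
  rw [hpow, left_eq_add, ← Nat.cast_smul_eq_nsmul F, smul_eq_zero] at h
  exact sub_eq_zero.mp (h.resolve_left hb)

theorem eq_one_of_mulVec_eq (hdet : C.det = 1) (hpow : C ^ b = 1) (hb : (b : F) ≠ 0)
    {v : Fin 2 → F} (hv : v ≠ 0) (h : C.mulVec v = v) : C = 1 := by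
  refine eq_one_of_trace_eq_two hdet ?_ hpow hb
  have h0 : (C - 1).det = 0 :=
    exists_mulVec_eq_zero_iff.mp ⟨v, hv, by rw [sub_mulVec, h, one_mulVec, sub_self]⟩
  rw [det_fin_two] at h0 hdet
  rw [trace_fin_two]
  simp at h0
  linear_combination hdet - h0

end Matrix

theorem ZMod.natCast_ne_zero_of_prime_ne {a b : ℕ} (ha : a.Prime) (hb : b.Prime) (hab : a ≠ b) :
    (b : ZMod a) ≠ 0 := by
  rw [Ne, ZMod.natCast_eq_zero_iff]
  exact fun h => hab ((Nat.prime_dvd_prime_iff_eq ha hb).mp h)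

namespace CyclicSq

variable {a b : ℕ}

theorem eq_one_of_slAction_eq [Fact a.Prime] {A : Matrix.SpecialLinearGroup (Fin 2) (ZMod a)}
    (hb : (b : ZMod a) ≠ 0) (hA : A ^ b = 1) (hA1 : A ≠ 1) {x : CyclicSq a}
    (h : slAction a A x = x) : x = 1 := by
  by_contra hx
  refine hA1 (Subtype.ext (Matrix.eq_one_of_mulVec_eq A.2 ?_ hb (v := x.toAdd) ?_ ?_))
  · exact (Matrix.SpecialLinearGroup.coe_pow A b).symm.trans (congrArg Subtype.val hA)
  · exact fun h => hx (Multiplicative.toAdd.injective h)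
  · exact congrArg Multiplicative.toAdd h

/-! ### Invariant non-degenerate cocycles on `C_a × C_a`. -/

section InvariantCocycle

variable {Γ : Type*} [Group Γ] [Fintype Γ]
  (ρ : Γ →* Matrix.SpecialLinearGroup (Fin 2) (ZMod a))

/-- The average over `Γ` of the bilinear form `x₀ y₁`. -/
def avgForm (x y : CyclicSq a) : ZMod a :=
  ∑ k, (slAction a (ρ k) x).toAdd 0 * (slAction a (ρ k) y).toAdd 1

theorem avgForm_mul_left (x x' y : CyclicSq a) :
    avgForm ρ (x * x') y = avgForm ρ x y + avgForm ρ x' y := by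
  simp [avgForm, add_mul, Finset.sum_add_distrib]

theorem avgForm_mul_right (x y y' : CyclicSq a) :
    avgForm ρ x (y * y') = avgForm ρ x y + avgForm ρ x y' := by
  simp [avgForm, mul_add, Finset.sum_add_distrib]

theorem avgForm_slAction (k : Γ) (x y : CyclicSq a) :
    avgForm ρ (slAction a (ρ k) x) (slAction a (ρ k) y) = avgForm ρ x y := by
  refine Fintype.sum_equiv (Equiv.mulRight k) _ _ fun h => ?_
  simp only [Equiv.coe_mulRight, map_mul, MulAut.mul_apply]

/-- Antisymmetrizing `x₀ y₁` gives the determinant, which `SL₂` preserves, so all summands agree.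
The sum is not divided by the order of `Γ`, hence the factor. -/
theorem avgForm_sub (x y : CyclicSq a) :
    avgForm ρ x y - avgForm ρ y x =
      Fintype.card Γ * (x.toAdd 0 * y.toAdd 1 - y.toAdd 0 * x.toAdd 1) := by
  rw [avgForm, avgForm, ← Finset.sum_sub_distrib, Finset.sum_congr rfl
    (g := fun _ => x.toAdd 0 * y.toAdd 1 - y.toAdd 0 * x.toAdd 1)]
  · simp [mul_sub]
  · intro k _
    have hdet := (ρ k).2
    rw [Matrix.det_fin_two] at hdet
    simp only [slAction_apply, toAdd_ofAdd, Matrix.mulVec, dotProduct, Fin.sum_univ_two]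
    linear_combination (x.toAdd 0 * y.toAdd 1 - y.toAdd 0 * x.toAdd 1) * hdet

variable [NeZero a]

/-- The standard embedding of `ℤ/a` in `ℂ*`. -/
noncomputable def charHom (a : ℕ) [NeZero a] : Multiplicative (ZMod a) →* ℂˣ :=
  (ZMod.stdAddChar (N := a)).toMonoidHom.toHomUnits

theorem charHom_injective : Function.Injective (charHom a) := by
  intro x y h
  exact ZMod.injective_stdAddChar (congrArg Units.val h)

/-- The bicharacter cocycle attached to `avgForm`. -/
noncomputable def avgCocycle : TwoCocycle (CyclicSq a) where
  toFun x y := charHom a (.ofAdd (avgForm ρ x y))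
  cocycle x y z := by
    rw [← map_mul (charHom a), ← map_mul (charHom a), ← ofAdd_add, ← ofAdd_add, avgForm_mul_left,
      avgForm_mul_right]
    ring_nf

/-- The cocycle itself is invariant, not merely its class; `TwoCocycle.semidirect` needs this. -/
theorem avgCocycle_slAction (k : Γ) (x y : CyclicSq a) :
    avgCocycle ρ (slAction a (ρ k) x) (slAction a (ρ k) y) = avgCocycle ρ x y :=
  congrArg (fun t => charHom a (.ofAdd t)) (avgForm_slAction ρ k x y)

theorem avgCocycle_hasNoRegular [Fact a.Prime] (hΓ : (Fintype.card Γ : ZMod a) ≠ 0) :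
    (avgCocycle ρ).HasNoRegular := by
  intro x hx
  have key : ∀ y, (avgCocycle ρ x y = avgCocycle ρ y x) →
      x.toAdd 0 * y.toAdd 1 - y.toAdd 0 * x.toAdd 1 = 0 := by
    intro y h
    have h1 : avgForm ρ x y = avgForm ρ y x := charHom_injective h
    have h2 := avgForm_sub ρ x y
    rw [h1, sub_self] at h2
    exact (mul_eq_zero.mp h2.symm).resolve_left hΓ
  by_contra! h
  apply hx
  apply Multiplicative.toAdd.injective
  ext i
  fin_cases i
  · simpa [e] using key (e 1) (h (e 1) (Commute.all _ _))
  · simpa [e] using key (e 0) (h (e 0) (Commute.all _ _))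

end InvariantCocycle

end CyclicSq

/-! ### Semidirect products through `SL₂` are of central type. -/

/-- The cocycle on `N ⋊ K` built from a `K`-invariant cocycle on `N` and a cocycle on `K`. -/
def TwoCocycle.semidirect {N K : Type*} [Group N] [Group K] {φ : K →* MulAut N}
    (f : TwoCocycle N) (hf : ∀ k x y, f (φ k x) (φ k y) = f x y) (g : TwoCocycle K) :
    TwoCocycle (N ⋊[φ] K) where
  toFun x y := f x.left (φ x.right y.left) * g x.right y.right
  cocycle x y z := by
    have h1 := f.cocycle x.left (φ x.right y.left) (φ x.right (φ y.right z.left))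
    rw [hf] at h1
    have h2 := g.cocycle x.right y.right z.right
    simp only [SemidirectProduct.mul_left, SemidirectProduct.mul_right, map_mul,
      MulAut.mul_apply]
    rw [mul_mul_mul_comm, h1, h2, mul_mul_mul_comm]

section CentralType

variable {a b : ℕ} [Fact a.Prime] [Fact b.Prime]
  (η : CyclicSq b →* Matrix.SpecialLinearGroup (Fin 2) (ZMod a))

theorem natCast_card_cyclicSq_ne_zero (hab : a ≠ b) :
    (Fintype.card (CyclicSq b) : ZMod a) ≠ 0 := by
  rw [← Nat.card_eq_fintype_card, CyclicSq.natCard, Nat.cast_pow]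
  exact pow_ne_zero _ (ZMod.natCast_ne_zero_of_prime_ne Fact.out Fact.out hab)

theorem isSymplecticAction_slAction (hab : a ≠ b) :
    IsSymplecticAction ((slAction a).comp η) := by
  refine ⟨CyclicSq.avgCocycle η, (CyclicSq.avgCocycle_hasNoRegular η
    (natCast_card_cyclicSq_ne_zero hab)).isNondegenerate, fun k => ⟨fun _ => 1, fun x y => ?_⟩⟩
  rw [inv_one, mul_one, mul_one, mul_one]
  have := CyclicSq.avgCocycle_slAction η k⁻¹ x y
  rw [map_inv, map_inv] at this
  exact this.symm

/-- If the `K`-part of an element acts trivially, a partner is found in one of the two factors. If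
it acts non-trivially, the element is conjugate into `K`, where the cocycle `g` provides the
partner. -/
theorem isOfCentralType_slSemidirect (hab : a ≠ b) : IsOfCentralType (SLSemidirect η) := by
  rw [isOfCentralType_iff]
  refine ⟨Finite.of_equiv _ SemidirectProduct.equivProd.symm, ?_⟩
  have hb0 := ZMod.natCast_ne_zero_of_prime_ne (Fact.out : a.Prime) (Fact.out : b.Prime) hab
  have hinv : ∀ k x y, CyclicSq.avgCocycle η ((slAction a).comp η k x)
      ((slAction a).comp η k y) = CyclicSq.avgCocycle η x y := CyclicSq.avgCocycle_slAction η
  have hN := CyclicSq.avgCocycle_hasNoRegular η (natCast_card_cyclicSq_ne_zero hab)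
  -- Summing over the trivial group `Unit` leaves the plain bicharacter `x₀ y₁` on `K`.
  have hK : (CyclicSq.avgCocycle
      (1 : Unit →* Matrix.SpecialLinearGroup (Fin 2) (ZMod b))).HasNoRegular :=
    CyclicSq.avgCocycle_hasNoRegular _ (by simp)
  set f := CyclicSq.avgCocycle η
  set g := CyclicSq.avgCocycle (1 : Unit →* Matrix.SpecialLinearGroup (Fin 2) (ZMod b))
  refine ⟨f.semidirect hinv g, ?_⟩
  have hcomm : ∀ k : CyclicSq b, k ≠ 1 → ∀ m : CyclicSq a,
      ∃ h : SLSemidirect η, Commute (SemidirectProduct.inl m * SemidirectProduct.inr k *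
          (SemidirectProduct.inl m)⁻¹) h ∧
        (f.semidirect hinv g).pairing (SemidirectProduct.inl m * SemidirectProduct.inr k *
          (SemidirectProduct.inl m)⁻¹) h ≠ 1 := by
    intro k hk m
    obtain ⟨k', -, hne⟩ := hK k hk
    have hc : Commute (SemidirectProduct.inr k : SLSemidirect η) (SemidirectProduct.inr k') :=
      (Commute.all k k').map SemidirectProduct.inr
    refine ⟨SemidirectProduct.inl m * SemidirectProduct.inr k' * (SemidirectProduct.inl m)⁻¹,
      (Commute.conj_iff _).mpr hc, ?_⟩
    rw [TwoCocycle.pairing_conj hc, TwoCocycle.pairing_ne_one_iff]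
    intro h
    apply hne
    simpa [TwoCocycle.semidirect] using h
  intro x hx
  simp only [← TwoCocycle.pairing_ne_one_iff]
  obtain ⟨n, k⟩ := x
  by_cases hk : η k = 1
  · by_cases hn : n = 1
    · have hk1 : k ≠ 1 := by
        rintro rfl
        exact hx (by rw [hn]; rfl)
      have := hcomm k hk1 1
      rw [map_one, inv_one, one_mul, mul_one] at this
      rwa [hn]
    · obtain ⟨n', -, hne⟩ := hN n hn
      refine ⟨SemidirectProduct.inl n', ?_, ?_⟩
      · ext1
        · simp [hk, mul_comm]
        · simp
      · rw [TwoCocycle.pairing_ne_one_iff]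
        intro h
        apply hne
        simpa [TwoCocycle.semidirect, hk, TwistedGroupAlgebra.one_left g k,
          TwistedGroupAlgebra.one_right g k] using h
  · have hpow : η k ^ b = 1 := by rw [← map_pow, CyclicSq.pow_eq_one, map_one]
    -- `η k ≠ 1` has no non-trivial fixed point, so `δ` is injective, hence onto; a preimage of `n`
    -- conjugates `k` to `(n, k)`.
    let δ : CyclicSq a →* CyclicSq a :=
      { toFun := fun m => m * (slAction a (η k) m)⁻¹
        map_one' := by simp
        map_mul' := fun m m' => by
          rw [map_mul, mul_inv]
          exact mul_mul_mul_comm _ _ _ _ }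
    have hδ : Function.Injective δ := by
      rw [injective_iff_map_eq_one]
      intro m hm
      exact CyclicSq.eq_one_of_slAction_eq hb0 hpow hk (mul_inv_eq_one.mp hm).symm
    obtain ⟨m, hm⟩ := Finite.surjective_of_injective hδ n
    have hx' : (⟨n, k⟩ : SLSemidirect η) = SemidirectProduct.inl m * SemidirectProduct.inr k *
          (SemidirectProduct.inl m)⁻¹ := by
      rw [← hm]
      ext1
      · simp [δ]
      · simp
    rw [hx']
    exact hcomm k (fun h => hk (by rw [h, map_one])) m

end CentralType

/-! ### Elements of prime order in `SL₂` over a field, up to conjugacy and powers. -/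

namespace Matrix

variable {F : Type*} [Field F] {b : ℕ}

/-- In the basis `v, X v` a matrix becomes its companion matrix. If none of `(1,0)`, `(0,1)`,
`(1,1)` is cyclic, all three are eigenvectors and `X` is scalar. -/
theorem exists_conj_companion {X : Matrix (Fin 2) (Fin 2) F} (hdet : X.det = 1)
    (hX : ∀ c : F, X ≠ c • 1) :
    ∃ P : Matrix (Fin 2) (Fin 2) F, P.det ≠ 0 ∧ X * P = P * !![0, -1; 1, X.trace] := by
  have key : ∀ v : Fin 2 → F,
      X * !![v 0, X.mulVec v 0; v 1, X.mulVec v 1] =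
        !![v 0, X.mulVec v 0; v 1, X.mulVec v 1] * !![0, -1; 1, X.trace] := by
    intro v
    rw [det_fin_two] at hdet
    ext i j
    fin_cases i <;> fin_cases j <;>
      simp [mul_apply, Fin.sum_univ_two, mulVec, dotProduct, trace_fin_two]
    · linear_combination -v 0 * hdet
    · linear_combination -v 1 * hdet
  by_contra! h
  have h' : ∀ v : Fin 2 → F, v 0 * X.mulVec v 1 - X.mulVec v 0 * v 1 = 0 := fun v => by
    have := mt (h !![v 0, X.mulVec v 0; v 1, X.mulVec v 1]) (not_not.mpr (key v))
    rwa [not_not, det_fin_two_of] at this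
  have h10 := h' ![1, 0]
  have h01 := h' ![0, 1]
  have h11 := h' ![1, 1]
  simp [mulVec, dotProduct, Fin.sum_univ_two] at h10 h01 h11
  refine hX (X 0 0) ?_
  ext i j
  fin_cases i <;> fin_cases j <;> simp [h10, h01]
  simp [h10, h01] at h11
  linear_combination h11

/-- Since `c² = 1`, the matrix `c • Y` has determinant 1 and trace 2, so it is the identity. -/
theorem eq_smul_one_of_trace_eq {X Y : Matrix (Fin 2) (Fin 2) F} (hY : Y.det = 1)
    (hXb : X ^ b = 1) (hYb : Y ^ b = 1) (hb : (b : F) ≠ 0) (htr : X.trace = Y.trace)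
    {c : F} (hX : X.det = 1) (hc : X = c • 1) : Y = c • 1 := by
  have hcc : c * c = 1 := by simpa [hc, sq] using hX
  have hc0 : c ≠ 0 := left_ne_zero_of_mul_eq_one hcc
  have hcb : c ^ b = 1 := by
    have := congrFun (congrFun hXb 0) 0
    simpa [hc, smul_pow] using this
  have h1 : c • Y = 1 := by
    refine eq_one_of_trace_eq_two (b := b) ?_ ?_ ?_ hb
    · simp [hY, sq, hcc]
    · rw [trace_smul, ← htr, hc]
      simp [hcc, ← mul_assoc]
    · rw [smul_pow, hcb, hYb, one_smul]
  rw [← h1, smul_smul, hcc, one_smul]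

theorem exists_conj_of_trace_eq {X Y : Matrix (Fin 2) (Fin 2) F} (hX : X.det = 1) (hY : Y.det = 1)
    (hXb : X ^ b = 1) (hYb : Y ^ b = 1) (hb : (b : F) ≠ 0) (htr : X.trace = Y.trace) :
    ∃ P : Matrix (Fin 2) (Fin 2) F, P.det ≠ 0 ∧ P * X = Y * P := by
  by_cases hXs : ∃ c : F, X = c • 1
  · obtain ⟨c, hc⟩ := hXs
    refine ⟨1, by simp, ?_⟩
    rw [eq_smul_one_of_trace_eq hY hXb hYb hb htr hX hc, hc, one_mul, mul_one]
  by_cases hYs : ∃ c : F, Y = c • 1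
  · obtain ⟨c, hc⟩ := hYs
    refine ⟨1, by simp, ?_⟩
    rw [eq_smul_one_of_trace_eq hX hYb hXb hb htr.symm hY hc, hc, one_mul, mul_one]
  push Not at hXs hYs
  obtain ⟨P, hP, hPX⟩ := exists_conj_companion hX hXs
  obtain ⟨Q, hQ, hQY⟩ := exists_conj_companion hY hYs
  rw [htr] at hPX
  have hP' : IsUnit P.det := hP.isUnit
  refine ⟨Q * P⁻¹, ?_, ?_⟩
  · rw [det_mul, det_nonsing_inv, Ring.inverse_eq_inv']
    exact mul_ne_zero hQ (inv_ne_zero hP)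
  · have h2 : P⁻¹ * X = !![0, -1; 1, Y.trace] * P⁻¹ := by
      have h3 := congrArg (fun M => P⁻¹ * M * P⁻¹) hPX
      simpa [← mul_assoc, nonsing_inv_mul _ hP', mul_nonsing_inv_cancel_right _ _ hP'] using h3
    rw [mul_assoc, h2, ← mul_assoc, ← mul_assoc, hQY]

theorem pow_mulVec_eq {X : Matrix (Fin 2) (Fin 2) F} {v : Fin 2 → F} {l : F}
    (h : X.mulVec v = l • v) (n : ℕ) : (X ^ n).mulVec v = l ^ n • v := by
  induction n with
  | zero => simp
  | succ n ih => rw [pow_succ, ← mulVec_mulVec, h, mulVec_smul, ih, smul_smul, pow_succ']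

theorem trace_eq_of_mulVec_eq {X : Matrix (Fin 2) (Fin 2) F} (hX : X.det = 1) {v : Fin 2 → F}
    (hv : v ≠ 0) {l : F} (h : X.mulVec v = l • v) : X.trace = l + l⁻¹ := by
  have h0 : (X - l • 1).det = 0 :=
    exists_mulVec_eq_zero_iff.mp ⟨v, hv, by rw [sub_mulVec, h, smul_mulVec, one_mulVec, sub_self]⟩
  rw [det_fin_two] at h0 hX
  rw [trace_fin_two]
  simp at h0
  have h1 : l * (X 0 0 + X 1 1 - l) = 1 := by linear_combination hX - h0
  rw [← eq_inv_of_mul_eq_one_right h1]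
  ring

theorem exists_common_eigenvector [IsAlgClosed F] {X Y : Matrix (Fin 2) (Fin 2) F}
    (hXY : Commute X Y) :
    ∃ v : Fin 2 → F, v ≠ 0 ∧ (∃ l : F, X.mulVec v = l • v) ∧ ∃ m : F, Y.mulVec v = m • v := by
  obtain ⟨l, hl⟩ := Module.End.exists_eigenvalue (toLin' X)
  have hmaps : Set.MapsTo (toLin' Y) (Module.End.eigenspace (toLin' X) l)
      (Module.End.eigenspace (toLin' X) l) := by
    intro w hw
    simp only [SetLike.mem_coe, Module.End.mem_eigenspace_iff, toLin'_apply] at hw ⊢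
    rw [mulVec_mulVec, hXY.eq, ← mulVec_mulVec, hw, mulVec_smul]
  have : Nontrivial (Module.End.eigenspace (toLin' X) l) := Submodule.nontrivial_iff_ne_bot.mpr hl
  obtain ⟨m, hm⟩ := Module.End.exists_eigenvalue ((toLin' Y).restrict hmaps)
  obtain ⟨w, hw⟩ := hm.exists_hasEigenvector
  refine ⟨w, fun h => hw.2 (Subtype.ext h), ⟨l, ?_⟩, ⟨m, ?_⟩⟩
  · simpa using Module.End.mem_eigenspace_iff.mp w.2
  · exact congrArg Subtype.val hw.apply_eq_smul

end Matrix

namespace Matrix.SpecialLinearGroup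

variable {F : Type*} [Field F] {b : ℕ} {A B : SpecialLinearGroup (Fin 2) F}

theorem eq_one_of_mulVec (hb : (b : F) ≠ 0) (hA : A ^ b = 1) {v : Fin 2 → F} (hv : v ≠ 0)
    (h : A.1.mulVec v = v) : A = 1 :=
  Subtype.ext (eq_one_of_mulVec_eq A.2 ((coe_pow A b).symm.trans (congrArg Subtype.val hA)) hb hv h)

theorem pow_eq_one_of_mulVec (hB : B ^ b = 1)
    {v : Fin 2 → F} (hv : v ≠ 0) {m : F} (h : B.1.mulVec v = m • v) : m ^ b = 1 := by
  have h1 := pow_mulVec_eq h b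
  rw [← coe_pow, hB, coe_one, one_mulVec] at h1
  have h2 : (m ^ b - 1) • v = 0 := by rw [sub_smul, ← h1, one_smul, sub_self]
  exact sub_eq_zero.mp ((smul_eq_zero.mp h2).resolve_right hv)

theorem isPrimitiveRoot_of_mulVec [Fact b.Prime] (hb : (b : F) ≠ 0) (hA : A ^ b = 1) (hA1 : A ≠ 1)
    {v : Fin 2 → F} (hv : v ≠ 0) {l : F} (h : A.1.mulVec v = l • v) : IsPrimitiveRoot l b := by
  have hl : l ^ b = 1 := pow_eq_one_of_mulVec hA hv h
  have hl1 : l ≠ 1 := by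
    rintro rfl
    exact hA1 (eq_one_of_mulVec hb hA hv (by rw [h, one_smul]))
  rw [← orderOf_eq_prime hl hl1]
  exact IsPrimitiveRoot.orderOf l

/-- On a common eigenvector `A` acts by a primitive `b`-th root of unity and `B` by some power of
it, say the `i`-th. Then `A⁻ⁱ B` fixes the vector and has exponent `b`, so it is 1. -/
theorem exists_eq_pow_of_commute_of_isAlgClosed [IsAlgClosed F] [Fact b.Prime] (hb : (b : F) ≠ 0)
    (hA : A ^ b = 1) (hA1 : A ≠ 1) (hB : B ^ b = 1) (hAB : Commute A B) : ∃ i : ℕ, B = A ^ i := by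
  have hAB' : Commute A.1 B.1 := congrArg Subtype.val hAB.eq
  obtain ⟨v, hv, ⟨l, hl⟩, m, hm⟩ := exists_common_eigenvector hAB'
  obtain ⟨i, -, hi⟩ := (isPrimitiveRoot_of_mulVec hb hA hA1 hv hl).eq_pow_of_pow_eq_one
    (pow_eq_one_of_mulVec hB hv hm)
  have hAi : (A ^ i).1.mulVec v = m • v := by
    rw [← hi, coe_pow]
    exact pow_mulVec_eq hl i
  refine ⟨i, (inv_mul_eq_one.mp ?_).symm⟩
  refine eq_one_of_mulVec (b := b) hb ?_ hv ?_
  · have hc : Commute (A ^ i)⁻¹ B := (hAB.pow_left i).inv_left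
    rw [hc.mul_pow, inv_pow, ← pow_mul, mul_comm, pow_mul, hA, hB]
    simp
  · have hm0 : m ≠ 0 := by
      rintro rfl
      have := pow_eq_one_of_mulVec hB hv hm
      rw [zero_pow (Fact.out : b.Prime).ne_zero] at this
      exact zero_ne_one this
    rw [coe_mul, ← mulVec_mulVec, hm, ← hAi, mulVec_mulVec, ← coe_mul, inv_mul_cancel, coe_one,
      one_mulVec]

/-- The trace is `m + m⁻¹` for an eigenvalue `m`, and an eigenvalue of `B` is a power of one of `A`.
-/
theorem exists_trace_eq_of_isAlgClosed [IsAlgClosed F] [Fact b.Prime] (hb : (b : F) ≠ 0)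
    (hA : A ^ b = 1) (hA1 : A ≠ 1) (hB : B ^ b = 1) :
    ∃ i : ℕ, (A ^ i).1.trace = B.1.trace := by
  obtain ⟨v, hv, ⟨l, hl⟩, -⟩ := exists_common_eigenvector (Commute.refl A.1)
  obtain ⟨w, hw, ⟨m, hm⟩, -⟩ := exists_common_eigenvector (Commute.refl B.1)
  obtain ⟨i, -, hi⟩ := (isPrimitiveRoot_of_mulVec hb hA hA1 hv hl).eq_pow_of_pow_eq_one
    (pow_eq_one_of_mulVec hB hw hm)
  refine ⟨i, ?_⟩
  rw [trace_eq_of_mulVec_eq B.2 hw hm, trace_eq_of_mulVec_eq (A ^ i).2 hv (l := m)]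
  rw [← hi, coe_pow]
  exact pow_mulVec_eq hl i

theorem map_algebraMap_injective (K : Type*) [Field K] [Algebra F K] :
    Function.Injective (map (n := Fin 2) (algebraMap F K)) := by
  intro X Y h
  ext i j
  have := congrFun (congrFun (congrArg Subtype.val h) i) j
  exact (algebraMap F K).injective this

theorem exists_eq_pow_of_commute [Fact b.Prime] (hb : (b : F) ≠ 0)
    (hA : A ^ b = 1) (hA1 : A ≠ 1) (hB : B ^ b = 1) (hAB : Commute A B) : ∃ i : ℕ, B = A ^ i := by
  have hinj := map_algebraMap_injective (F := F) (AlgebraicClosure F)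
  obtain ⟨i, hi⟩ := exists_eq_pow_of_commute_of_isAlgClosed (b := b)
    (A := map (algebraMap F (AlgebraicClosure F)) A)
    (B := map (algebraMap F (AlgebraicClosure F)) B)
    (by simpa using (map_ne_zero (algebraMap F (AlgebraicClosure F))).mpr hb)
    (by rw [← map_pow, hA, map_one]) (fun h => hA1 (hinj (h.trans (map_one _).symm)))
    (by rw [← map_pow, hB, map_one]) (hAB.map _)
  exact ⟨i, hinj (by rw [hi, map_pow])⟩

theorem exists_trace_eq [Fact b.Prime] (hb : (b : F) ≠ 0)
    (hA : A ^ b = 1) (hA1 : A ≠ 1) (hB : B ^ b = 1) :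
    ∃ i : ℕ, (A ^ i).1.trace = B.1.trace := by
  have hinj := map_algebraMap_injective (F := F) (AlgebraicClosure F)
  obtain ⟨i, hi⟩ := exists_trace_eq_of_isAlgClosed (b := b)
    (A := map (algebraMap F (AlgebraicClosure F)) A)
    (B := map (algebraMap F (AlgebraicClosure F)) B)
    (by simpa using (map_ne_zero (algebraMap F (AlgebraicClosure F))).mpr hb)
    (by rw [← map_pow, hA, map_one]) (fun h => hA1 (hinj (h.trans (map_one _).symm)))
    (by rw [← map_pow, hB, map_one])
  refine ⟨i, (algebraMap F (AlgebraicClosure F)).injective ?_⟩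
  rw [← map_pow] at hi
  rw [trace_fin_two, trace_fin_two] at hi ⊢
  rw [map_add, map_add]
  exact hi

/-- Conjugacy in `GL₂` suffices here, as `P` only has to give an automorphism of `C_a × C_a`. -/
theorem exists_conj_pow [Fact b.Prime] (hb : (b : F) ≠ 0)
    (hA : A ^ b = 1) (hA1 : A ≠ 1) (hB : B ^ b = 1) :
    ∃ (i : ℕ) (P : Matrix (Fin 2) (Fin 2) F), P.det ≠ 0 ∧ P * (A ^ i).1 = B.1 * P := by
  obtain ⟨i, hi⟩ := exists_trace_eq hb hA hA1 hB
  have hAi : (A ^ i) ^ b = 1 := by rw [← pow_mul, mul_comm, pow_mul, hA, one_pow]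
  obtain ⟨P, hP⟩ := exists_conj_of_trace_eq (A ^ i).2 B.2
    ((coe_pow (A ^ i) b).symm.trans (congrArg Subtype.val hAi))
    ((coe_pow B b).symm.trans (congrArg Subtype.val hB)) hb hi
  exact ⟨i, P, hP⟩

end Matrix.SpecialLinearGroup

/-! ### Uniqueness of the non-trivial semidirect product. -/

namespace CyclicSq

variable {a b : ℕ} [Fact a.Prime] [Fact b.Prime]

/-- If `η` were injective, `η (e 1)` would be a power of `η (e 0)`, hence `e 1` a power of `e 0`. -/
theorem exists_mem_ker_ne_one (hab : a ≠ b)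
    (η : CyclicSq b →* Matrix.SpecialLinearGroup (Fin 2) (ZMod a)) : ∃ l, l ≠ 1 ∧ η l = 1 := by
  have hb0 := ZMod.natCast_ne_zero_of_prime_ne (Fact.out : a.Prime) (Fact.out : b.Prime) hab
  have hpow : ∀ x, η x ^ b = 1 := fun x => by rw [← map_pow, pow_eq_one, map_one]
  by_contra! h
  have hinj : Function.Injective η := by
    rw [injective_iff_map_eq_one]
    intro x hx
    by_contra hx1
    exact h x hx1 hx
  have he : (e 0 : CyclicSq b) ≠ 1 := fun h => by
    have := congrFun (congrArg Multiplicative.toAdd h) 0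
    simp [e] at this
  obtain ⟨i, hi⟩ := Matrix.SpecialLinearGroup.exists_eq_pow_of_commute hb0 (hpow (e 0))
    (fun h0 => he (hinj (h0.trans (map_one η).symm))) (hpow (e 1)) ((Commute.all _ _).map η)
  rw [← map_pow] at hi
  have := congrFun (congrArg Multiplicative.toAdd (hinj hi)) 1
  simp [e] at this

/-- The endomorphism of `C_b × C_b` with prescribed values on the standard basis. -/
def homOfBasis (k l : CyclicSq b) : CyclicSq b →* CyclicSq b :=
  AddMonoidHom.toMultiplicative
    (Matrix.toLin' !![k.toAdd 0, l.toAdd 0; k.toAdd 1, l.toAdd 1]).toAddMonoidHom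

theorem homOfBasis_e_zero (k l : CyclicSq b) : homOfBasis k l (e 0) = k := by
  apply Multiplicative.toAdd.injective
  ext i
  fin_cases i <;> simp [homOfBasis, e]

theorem homOfBasis_e_one (k l : CyclicSq b) : homOfBasis k l (e 1) = l := by
  apply Multiplicative.toAdd.injective
  ext i
  fin_cases i <;> simp [homOfBasis, e]

theorem exists_mulAut {M : Type*} [Group M] (η : CyclicSq b →* M) {k l : CyclicSq b}
    (hk : η k ≠ 1) (hl : η l = 1) (hl1 : l ≠ 1) :
    ∃ T : MulAut (CyclicSq b), T (e 0) = k ∧ T (e 1) = l := by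
  have hinj : Function.Injective (homOfBasis k l) := by
    rw [injective_iff_map_eq_one]
    intro x hx
    rw [eq_e_pow x, map_mul, map_pow, map_pow, homOfBasis_e_zero, homOfBasis_e_one] at hx
    have h0 : (x.toAdd 0).val = 0 := by
      have h1 := congrArg η hx
      rw [map_mul, map_pow, map_pow, hl, one_pow, mul_one, map_one] at h1
      rw [← Nat.mod_eq_of_lt (ZMod.val_lt (x.toAdd 0))]
      refine Nat.mod_eq_zero_of_dvd ?_
      have : orderOf (η k) = b := orderOf_eq_prime (by rw [← map_pow, pow_eq_one, map_one]) hk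
      exact this.symm.dvd.trans (orderOf_dvd_of_pow_eq_one h1)
    have h1 : (x.toAdd 1).val = 0 := by
      rw [h0, pow_zero, one_mul] at hx
      rw [← Nat.mod_eq_of_lt (ZMod.val_lt (x.toAdd 1))]
      refine Nat.mod_eq_zero_of_dvd ?_
      have : orderOf l = b := orderOf_eq_prime (pow_eq_one l) hl1
      exact this.symm.dvd.trans (orderOf_dvd_of_pow_eq_one hx)
    rw [eq_e_pow x, h0, h1]
    simp
  exact ⟨MulEquiv.ofBijective _ (Finite.injective_iff_bijective.mp hinj),
    homOfBasis_e_zero k l, homOfBasis_e_one k l⟩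

/-- Any two nontrivial actions of `C_b × C_b` on `C_a × C_a` through `SL₂` give isomorphic
semidirect products. -/
theorem nonempty_slSemidirect_mulEquiv (hab : a ≠ b)
    {η η' : CyclicSq b →* Matrix.SpecialLinearGroup (Fin 2) (ZMod a)} (hη : η ≠ 1) (hη' : η' ≠ 1) :
    Nonempty (SLSemidirect η ≃* SLSemidirect η') := by
  have hb0 := ZMod.natCast_ne_zero_of_prime_ne (Fact.out : a.Prime) (Fact.out : b.Prime) hab
  obtain ⟨k, hk⟩ := DFunLike.ne_iff.mp hη
  obtain ⟨k', hk'⟩ := DFunLike.ne_iff.mp hη'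
  rw [MonoidHom.one_apply] at hk hk'
  obtain ⟨i, P, hP, hPk⟩ := Matrix.SpecialLinearGroup.exists_conj_pow (b := b) hb0
    (A := η k) (B := η' k') (by rw [← map_pow, pow_eq_one, map_one]) hk
    (by rw [← map_pow, pow_eq_one, map_one])
  have hPu : IsUnit P.det := hP.isUnit
  rw [← map_pow] at hPk
  generalize k ^ i = m at hPk
  have hm : η m ≠ 1 := by
    intro h
    apply hk'
    rw [h, Matrix.SpecialLinearGroup.coe_one, mul_one] at hPk
    apply Subtype.ext
    have := congrArg (· * P⁻¹) hPk
    simpa [Matrix.mul_nonsing_inv _ hPu, Matrix.mul_nonsing_inv_cancel_right _ _ hPu] using this.symm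
  obtain ⟨l, hl1, hl⟩ := exists_mem_ker_ne_one hab η
  obtain ⟨l', hl1', hl'⟩ := exists_mem_ker_ne_one hab η'
  -- The bases `(m, l)` and `(k', l')` have second vector in the kernel, so each homomorphism is
  -- determined by its value on the first vector, and `P` intertwines these two values.
  obtain ⟨T, hT0, hT1⟩ := exists_mulAut η hm hl hl1
  obtain ⟨T', hT0', hT1'⟩ := exists_mulAut η' hk' hl' hl1'
  have key : ∀ x, P * (η (T x)).1 = (η' (T' x)).1 * P := by
    intro x
    rw [eq_e_pow x]
    simp only [map_mul, map_pow, hT0, hT1, hT0', hT1', hl, hl', one_pow, mul_one,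
      Matrix.SpecialLinearGroup.coe_pow]
    exact (SemiconjBy.pow_right (show SemiconjBy P (η m).1 (η' k').1 from hPk) _).eq
  let := P.invertibleOfIsUnitDet hPu
  let fn : CyclicSq a ≃* CyclicSq a :=
    AddEquiv.toMultiplicative
      (Matrix.toLin'OfInv P.inv_mul_of_invertible P.mul_inv_of_invertible).toAddEquiv
  refine ⟨SemidirectProduct.congr fn (T.symm.trans T') fun g => ?_⟩
  obtain ⟨x, rfl⟩ := T.surjective g
  have e : (T.symm.trans T') (T x) = T' x := congrArg T' (T.symm_apply_apply x)
  rw [e]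
  refine MulEquiv.ext fun n => ?_
  apply Multiplicative.toAdd.injective
  have : P.mulVec ((η (T x)).1.mulVec n.toAdd) = (η' (T' x)).1.mulVec (P.mulVec n.toAdd) := by
    rw [Matrix.mulVec_mulVec, Matrix.mulVec_mulVec, key]
  exact this

end CyclicSq

/-! ### Existence of non-trivial actions and non-isomorphism of the products. -/

namespace CyclicSq

variable {a b : ℕ}

/-- The homomorphism `C_b × C_b → M` sending `x` to `A ^ x₀`, for `A ^ b = 1`. -/
def powHom [NeZero b] {M : Type*} [Monoid M] (A : M) (hA : A ^ b = 1) : CyclicSq b →* M where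
  toFun x := A ^ (x.toAdd 0).val
  map_one' := by simp
  map_mul' x y := by
    rw [toAdd_mul, Pi.add_apply, ZMod.val_add, ← pow_add, ← pow_eq_pow_mod _ hA]

theorem powHom_ne_one [Fact b.Prime] {M : Type*} [Monoid M] {A : M} (hA : A ^ b = 1)
    (hA1 : A ≠ 1) : powHom A hA ≠ 1 := by
  intro h
  apply hA1
  have := DFunLike.congr_fun h (e 0)
  simpa [powHom, e, ZMod.val_one] using this

section Existence

variable [Fact a.Prime] [Fact b.Prime]

theorem natCard_GL_two : Nat.card (GL (Fin 2) (ZMod a)) = (a - 1) * (a + 1) * (a * (a - 1)) := by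
  rw [Matrix.card_GL_field]
  simp only [Fin.prod_univ_two, ZMod.card, Fin.val_zero, Fin.val_one, pow_zero, pow_one]
  rw [mul_comm (a - 1), ← Nat.sq_sub_sq, one_pow, Nat.mul_sub a, mul_one, ← sq]

theorem dvd_of_exists_ne_one (hab : a ≠ b) {A : Matrix.SpecialLinearGroup (Fin 2) (ZMod a)}
    (hA : A ^ b = 1) (hA1 : A ≠ 1) : b ∣ a - 1 ∨ b ∣ a + 1 := by
  have hb : b.Prime := Fact.out
  have h : b ∣ Nat.card (GL (Fin 2) (ZMod a)) := by
    rw [← orderOf_eq_prime hA hA1, ← orderOf_injective Matrix.SpecialLinearGroup.toGL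
      Matrix.SpecialLinearGroup.toGL_injective]
    exact orderOf_dvd_natCard _
  rw [natCard_GL_two, hb.dvd_mul, hb.dvd_mul, hb.dvd_mul] at h
  rcases h with h | h | h
  · exact h
  · exact absurd ((Nat.prime_dvd_prime_iff_eq hb Fact.out).mp h).symm hab
  · exact Or.inl h

/-- If `b ∣ a - 1`, take a diagonal matrix with inverse entries of order `b`. Otherwise an element
of order `b` in `GL₂` has determinant of order dividing both `b` and `a - 1`, so 1. -/
theorem exists_ne_one_of_dvd (h : b ∣ a - 1 ∨ b ∣ a + 1) :
    ∃ A : Matrix.SpecialLinearGroup (Fin 2) (ZMod a), A ^ b = 1 ∧ A ≠ 1 := by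
  have hb : b.Prime := Fact.out
  by_cases h1 : b ∣ a - 1
  · obtain ⟨c, hc⟩ := exists_prime_orderOf_dvd_card' (G := (ZMod a)ˣ) b
      (by rwa [Nat.card_eq_fintype_card, ZMod.card_units])
    have hcb : c ^ b = 1 := by rw [← hc, pow_orderOf_eq_one]
    obtain ⟨x, y, hxy, hx, hy, hx1⟩ :
        ∃ x y : ZMod a, x * y = 1 ∧ x ^ b = 1 ∧ y ^ b = 1 ∧ x ≠ 1 := by
      refine ⟨c, (c⁻¹ : (ZMod a)ˣ), c.mul_inv, ?_, ?_, fun h0 => ?_⟩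
      · rw [← Units.val_pow_eq_pow_val, hcb, Units.val_one]
      · rw [← Units.val_pow_eq_pow_val, inv_pow, hcb, inv_one, Units.val_one]
      · rw [Units.ext (h0.trans Units.val_one.symm), orderOf_one] at hc
        exact hb.one_lt.ne hc
    let A : Matrix.SpecialLinearGroup (Fin 2) (ZMod a) :=
      ⟨Matrix.diagonal ![x, y], by
        rw [Matrix.det_diagonal, Fin.prod_univ_two]
        exact hxy⟩
    refine ⟨A, ?_, fun hA1 => hx1 ?_⟩
    · apply Subtype.ext
      rw [Matrix.SpecialLinearGroup.coe_pow, Matrix.SpecialLinearGroup.coe_one]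
      rw [Matrix.diagonal_pow, ← Matrix.diagonal_one]
      congr 1
      ext i
      fin_cases i
      · simpa using hx
      · simpa using hy
    · exact congrFun (congrFun (congrArg Subtype.val hA1) 0) 0
  · have h2 := h.resolve_left h1
    obtain ⟨g, hg⟩ := exists_prime_orderOf_dvd_card' (G := GL (Fin 2) (ZMod a)) b (by
      rw [natCard_GL_two]
      exact Dvd.dvd.mul_right (Dvd.dvd.mul_left h2 _) _)
    have hgb : g ^ b = 1 := by rw [← hg, pow_orderOf_eq_one]
    have hdet : Matrix.GeneralLinearGroup.det g = 1 := by
      have h3 : Matrix.GeneralLinearGroup.det g ^ b = 1 := by rw [← map_pow, hgb, map_one]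
      have h4 := ZMod.units_pow_card_sub_one_eq_one a (Matrix.GeneralLinearGroup.det g)
      exact (pow_eq_one_iff_of_coprime ((Nat.Prime.coprime_iff_not_dvd hb).mpr h1)).mp ⟨h3, h4⟩
    let A : Matrix.SpecialLinearGroup (Fin 2) (ZMod a) := ⟨g.1, congrArg Units.val hdet⟩
    refine ⟨A, ?_, ?_⟩
    · apply Subtype.ext
      rw [Matrix.SpecialLinearGroup.coe_pow]
      exact congrArg Units.val hgb
    · intro hA1
      have h3 : g = 1 := Units.ext (congrArg Subtype.val hA1)
      rw [h3, orderOf_one] at hg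
      exact hb.one_lt.ne hg

theorem exists_hom_ne_one (h : b ∣ a - 1 ∨ b ∣ a + 1) :
    ∃ η : CyclicSq b →* Matrix.SpecialLinearGroup (Fin 2) (ZMod a), η ≠ 1 := by
  obtain ⟨A, hA, hA1⟩ := exists_ne_one_of_dvd h
  exact ⟨powHom A hA, powHom_ne_one hA hA1⟩

end Existence

/-- `C_{ab} × C_{ab} ≅ (C_a × C_a) × (C_b × C_b)` for coprime `a`, `b`. -/
def mulEquivProd (hab : a.Coprime b) : CyclicSq (a * b) ≃* CyclicSq a × CyclicSq b :=
  MulEquiv.trans (AddEquiv.toMultiplicative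
    ((AddEquiv.piCongrRight fun _ => (ZMod.chineseRemainder hab).toAddEquiv).trans
      { toFun := fun x => (fun i => (x i).1, fun i => (x i).2)
        invFun := fun x i => (x.1 i, x.2 i)
        map_add' := fun _ _ => rfl }))
    (MulEquiv.prodMultiplicative _ _)

theorem nonempty_mulEquiv_of_eq_one (hab : a.Coprime b)
    {η : CyclicSq b →* Matrix.SpecialLinearGroup (Fin 2) (ZMod a)} (hη : η = 1) :
    Nonempty (CyclicSq (a * b) ≃* SLSemidirect η) := by
  subst hη
  have h : (slAction a).comp (1 : CyclicSq b →* Matrix.SpecialLinearGroup (Fin 2) (ZMod a)) = 1 :=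
    MonoidHom.comp_one _
  refine ⟨(mulEquivProd hab).trans ?_⟩
  unfold SLSemidirect
  rw [h]
  exact SemidirectProduct.mulEquivProd.symm

theorem exists_not_commute {η : CyclicSq b →* Matrix.SpecialLinearGroup (Fin 2) (ZMod a)}
    (hη : η ≠ 1) : ¬ ∀ x y : SLSemidirect η, x * y = y * x := by
  intro h
  apply hη
  refine MonoidHom.ext fun k => slAction_injective (MulEquiv.ext fun n => ?_)
  have := congrArg SemidirectProduct.left
    (h (SemidirectProduct.inr k) (SemidirectProduct.inl n))
  simpa using this

theorem isEmpty_mulEquiv_of_comm {M : Type*} [Mul M] (hM : ∀ x y : M, x * y = y * x)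
    {η : CyclicSq b →* Matrix.SpecialLinearGroup (Fin 2) (ZMod a)}
    (hη : η ≠ 1) : IsEmpty (M ≃* SLSemidirect η) :=
  ⟨fun φ => exists_not_commute hη fun x y => φ.symm.injective (by
    rw [map_mul, map_mul, hM])⟩

/-- Elements of `(C_a × C_a) ⋊ (C_b × C_b)` of exponent `a` lie in the abelian kernel. -/
theorem commute_of_pow_eq_one (hab : a.Coprime b)
    {η : CyclicSq b →* Matrix.SpecialLinearGroup (Fin 2) (ZMod a)} {x y : SLSemidirect η}
    (hx : x ^ a = 1) (hy : y ^ a = 1) : Commute x y := by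
  have key : ∀ z : SLSemidirect η, z ^ a = 1 → z.right = 1 := by
    intro z hz
    have h1 : z.right ^ a = 1 := by
      have := congrArg SemidirectProduct.rightHom hz
      rwa [map_pow, map_one] at this
    exact (pow_eq_one_iff_of_coprime hab).mp ⟨h1, pow_eq_one _⟩
  ext1
  · simp [key x hx, key y hy, mul_comm]
  · simp [mul_comm]

/-- Elements of exponent `b` commute pairwise on the right-hand side, being in the normal factor; on
the left, `k` acting non-trivially does not commute with its conjugates by `n ≠ 1`. -/
theorem isEmpty_slSemidirect_mulEquiv [Fact a.Prime] [Fact b.Prime] (hab : a ≠ b)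
    {η : CyclicSq b →* Matrix.SpecialLinearGroup (Fin 2) (ZMod a)} (hη : η ≠ 1)
    (θ : CyclicSq a →* Matrix.SpecialLinearGroup (Fin 2) (ZMod b)) :
    IsEmpty (SLSemidirect η ≃* SLSemidirect θ) := by
  have hb0 := ZMod.natCast_ne_zero_of_prime_ne (Fact.out : a.Prime) (Fact.out : b.Prime) hab
  refine ⟨fun φ => ?_⟩
  obtain ⟨k, hk⟩ := DFunLike.ne_iff.mp hη
  rw [MonoidHom.one_apply] at hk
  have hpow : η k ^ b = 1 := by rw [← map_pow, pow_eq_one, map_one]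
  have hcomm : ∀ x y : SLSemidirect η, x ^ b = 1 → y ^ b = 1 → Commute x y := by
    intro x y hx hy
    have h := commute_of_pow_eq_one
      (((Nat.coprime_primes Fact.out Fact.out).mpr hab).symm)
      (show φ x ^ b = 1 by rw [← map_pow, hx, map_one])
      (show φ y ^ b = 1 by rw [← map_pow, hy, map_one])
    exact φ.injective (by rw [map_mul, map_mul, h.eq])
  have hfix : ∀ n : CyclicSq a, n = 1 := by
    intro n
    have hr : (SemidirectProduct.inr k : SLSemidirect η) ^ b = 1 := by
      rw [← map_pow, pow_eq_one, map_one]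
    have h := hcomm (SemidirectProduct.inr k) (SemidirectProduct.inl n *
      SemidirectProduct.inr k * (SemidirectProduct.inl n)⁻¹) hr (by
        rw [conj_pow, hr, mul_one, mul_inv_cancel])
    have h1 := congrArg SemidirectProduct.left h.eq
    simp only [SemidirectProduct.mul_left, SemidirectProduct.left_inr, SemidirectProduct.left_inl,
      SemidirectProduct.right_inl, SemidirectProduct.right_inr, SemidirectProduct.mul_right,
      SemidirectProduct.inv_left, map_one, one_mul, mul_one, inv_one, MulAut.one_apply] at h1
    -- Commuting means that `k` fixes `n (k·n)⁻¹`; fixed-point-freeness is used here and once more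
    -- for `n`.
    have h2 := eq_one_of_slAction_eq hb0 hpow hk h1
    have h3 : n = slAction a (η k) n := by
      simpa [mul_inv_eq_one] using h2
    exact eq_one_of_slAction_eq hb0 hpow hk h3.symm
  have he := congrFun (congrArg Multiplicative.toAdd (hfix (e 0))) 0
  simp [e] at he

end CyclicSq

/-! ### Assembling the classification. -/

theorem modEq_one_or_neg_one_iff {p q : ℕ} (hq : 1 ≤ q) :
    ((q : ℤ) ≡ 1 [ZMOD p] ∨ (q : ℤ) ≡ -1 [ZMOD p]) ↔ (p ∣ q - 1 ∨ p ∣ q + 1) := by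
  rw [Int.modEq_comm, Int.modEq_comm (b := -1), Int.modEq_iff_dvd, Int.modEq_iff_dvd,
    sub_neg_eq_add, ← Int.natCast_dvd_natCast, ← Int.natCast_dvd_natCast, Nat.cast_sub hq]
  push_cast
  rfl

section Classification

variable {p q : ℕ} [Fact p.Prime] [Fact q.Prime]

theorem isOfCentralType_and_natCard_of_mulEquiv {a b : ℕ} [Fact a.Prime] [Fact b.Prime]
    (hab : a ≠ b) {G : Type*} [Group G]
    {η : CyclicSq b →* Matrix.SpecialLinearGroup (Fin 2) (ZMod a)} (φ : G ≃* SLSemidirect η) :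
    IsOfCentralType G ∧ Nat.card G = b ^ 2 * a ^ 2 := by
  refine ⟨(isOfCentralType_slSemidirect η hab).of_mulEquiv φ, ?_⟩
  rw [Nat.card_congr φ.toEquiv, SemidirectProduct.card, CyclicSq.natCard, CyclicSq.natCard,
    mul_comm]

theorem IsOfCentralType.exists_slSemidirect (hpq : p < q) {G : Type*} [Group G]
    (hG : IsOfCentralType G) (hcard : Nat.card G = p ^ 2 * q ^ 2) :
    (∃ η : CyclicSq p →* Matrix.SpecialLinearGroup (Fin 2) (ZMod q),
      Nonempty (G ≃* SLSemidirect η)) ∨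
    (q ∣ p + 1 ∧ ∃ θ : CyclicSq q →* Matrix.SpecialLinearGroup (Fin 2) (ZMod p),
      Nonempty (G ≃* SLSemidirect θ)) := by
  obtain ⟨-, f, hf⟩ := isOfCentralType_iff.mp hG
  rcases exists_normal_of_card_eq hpq hcard with ⟨N, hN, hNc⟩ | ⟨hdvd, N, hN, hNc⟩
  · exact Or.inl (hf.exists_slSemidirect hpq.ne' (by rw [hcard, mul_comm]) N hNc)
  · exact Or.inr ⟨hdvd, hf.exists_slSemidirect hpq.ne hcard N hNc⟩

theorem eq_two_and_eq_three_of_dvd (hpq : p < q) (h : q ∣ p + 1) : p = 2 ∧ q = 3 := by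
  have hp : p.Prime := Fact.out
  have hq : q.Prime := Fact.out
  have hqp : q = p + 1 := le_antisymm (Nat.le_of_dvd p.succ_pos h) hpq
  have h2 : p = 2 := by
    rcases hp.eq_two_or_odd' with h2 | h2
    · exact h2
    · have hev : Even q := by
        rw [hqp]
        exact h2.add_one
      have := (hq.even_iff).mp hev
      have := hp.two_le
      omega
  exact ⟨h2, by omega⟩

end Classification

theorem mainTheorem6 (p q : ℕ) (hp : p.Prime) (hq : q.Prime) (hpq : p < q) :
    (¬ ((q : ℤ) ≡ 1 [ZMOD p] ∨ (q : ℤ) ≡ -1 [ZMOD p]) →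
      ∀ (G : Type*) [Group G],
        (IsOfCentralType G ∧ Nat.card G = p ^ 2 * q ^ 2) ↔
          Nonempty (G ≃* CyclicSq (p * q))) ∧
    (3 < q → ((q : ℤ) ≡ 1 [ZMOD p] ∨ (q : ℤ) ≡ -1 [ZMOD p]) →
      ∃ η₁ η₂ : CyclicSq p →* Matrix.SpecialLinearGroup (Fin 2) (ZMod q),
        IsEmpty (SLSemidirect η₁ ≃* SLSemidirect η₂) ∧
        ∀ (G : Type*) [Group G],
          (IsOfCentralType G ∧ Nat.card G = p ^ 2 * q ^ 2) ↔
            (Nonempty (G ≃* SLSemidirect η₁) ∨ Nonempty (G ≃* SLSemidirect η₂))) ∧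
    (∃ (η : CyclicSq 2 →* Matrix.SpecialLinearGroup (Fin 2) (ZMod 3))
       (θ : CyclicSq 3 →* Matrix.SpecialLinearGroup (Fin 2) (ZMod 2)),
        IsSymplecticAction ((slAction 3).comp η) ∧
        IsSymplecticAction ((slAction 2).comp θ) ∧
        (¬ ∀ x y : SLSemidirect η, x * y = y * x) ∧
        (¬ ∀ x y : SLSemidirect θ, x * y = y * x) ∧
        IsEmpty (CyclicSq 6 ≃* SLSemidirect η) ∧
        IsEmpty (CyclicSq 6 ≃* SLSemidirect θ) ∧
        IsEmpty (SLSemidirect η ≃* SLSemidirect θ) ∧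
        ∀ (G : Type*) [Group G],
          (IsOfCentralType G ∧ Nat.card G = 36) ↔
            (Nonempty (G ≃* CyclicSq 6) ∨ Nonempty (G ≃* SLSemidirect η) ∨
              Nonempty (G ≃* SLSemidirect θ))) := by
  have := Fact.mk hp
  have := Fact.mk hq
  have hco : q.Coprime p := (Nat.coprime_primes hq hp).mpr hpq.ne'
  obtain ⟨ab⟩ := CyclicSq.nonempty_mulEquiv_of_eq_one hco
    (rfl : (1 : CyclicSq p →* Matrix.SpecialLinearGroup (Fin 2) (ZMod q)) = 1)
  rw [modEq_one_or_neg_one_iff hq.one_le]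
  refine ⟨fun h G _ => ⟨fun ⟨hG, hcard⟩ => ?_, fun ⟨φ⟩ => ?_⟩, fun h3 h => ?_, ?_⟩
  · rcases hG.exists_slSemidirect hpq hcard with ⟨η, ⟨φ⟩⟩ | ⟨hdvd, -⟩
    · have hη : η = 1 := by
        by_contra hη
        obtain ⟨k, hk⟩ := DFunLike.ne_iff.mp hη
        exact h (CyclicSq.dvd_of_exists_ne_one hpq.ne'
          (by rw [← map_pow, CyclicSq.pow_eq_one, map_one]) hk)
      subst hη
      rw [mul_comm]
      exact ⟨φ.trans ab.symm⟩
    · obtain ⟨rfl, rfl⟩ := eq_two_and_eq_three_of_dvd hpq hdvd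
      -- The exceptional pair `(2, 3)` satisfies `2 ∣ 3 - 1`.
      exact absurd (Or.inl ⟨1, rfl⟩) h
  · rw [mul_comm] at φ
    exact isOfCentralType_and_natCard_of_mulEquiv hpq.ne' (φ.trans ab)
  · obtain ⟨η, hη⟩ := CyclicSq.exists_hom_ne_one h
    -- The trivial homomorphism accounts for the abelian group.
    refine ⟨1, η, ?_, fun G _ => ⟨fun ⟨hG, hcard⟩ => ?_, ?_⟩⟩
    · exact CyclicSq.isEmpty_mulEquiv_of_comm
        (fun x y => ab.symm.injective (by
          rw [map_mul, map_mul]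
          exact mul_comm _ _)) hη
    · rcases hG.exists_slSemidirect hpq hcard with ⟨η', ⟨φ⟩⟩ | ⟨hdvd, -⟩
      · by_cases hη' : η' = 1
        · subst hη'
          exact Or.inl ⟨φ⟩
        · obtain ⟨ψ⟩ := CyclicSq.nonempty_slSemidirect_mulEquiv hpq.ne' hη' hη
          exact Or.inr ⟨φ.trans ψ⟩
      · have := (eq_two_and_eq_three_of_dvd hpq hdvd).2
        omega
    · rintro (⟨⟨φ⟩⟩ | ⟨⟨φ⟩⟩) <;> exact isOfCentralType_and_natCard_of_mulEquiv hpq.ne' φ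
  · have := Fact.mk Nat.prime_two
    have := Fact.mk Nat.prime_three
    obtain ⟨η, hη⟩ := CyclicSq.exists_hom_ne_one (a := 3) (b := 2) (by norm_num)
    obtain ⟨θ, hθ⟩ := CyclicSq.exists_hom_ne_one (a := 2) (b := 3) (by norm_num)
    obtain ⟨ab'⟩ := CyclicSq.nonempty_mulEquiv_of_eq_one (a := 3) (b := 2) (by norm_num)
      (rfl : (1 : CyclicSq 2 →* Matrix.SpecialLinearGroup (Fin 2) (ZMod 3)) = 1)
    refine ⟨η, θ, isSymplecticAction_slAction η (by norm_num),
      isSymplecticAction_slAction θ (by norm_num), CyclicSq.exists_not_commute hη,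
      CyclicSq.exists_not_commute hθ, CyclicSq.isEmpty_mulEquiv_of_comm mul_comm hη,
      CyclicSq.isEmpty_mulEquiv_of_comm mul_comm hθ,
      CyclicSq.isEmpty_slSemidirect_mulEquiv (by norm_num) hη θ,
      fun G _ => ⟨fun ⟨hG, hcard⟩ => ?_, ?_⟩⟩
    · rcases hG.exists_slSemidirect (p := 2) (q := 3) (by norm_num) hcard with
        ⟨η', ⟨φ⟩⟩ | ⟨-, θ', ⟨φ⟩⟩
      · by_cases hη' : η' = 1
        · subst hη'
          exact Or.inl ⟨φ.trans ab'.symm⟩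
        · obtain ⟨ψ⟩ := CyclicSq.nonempty_slSemidirect_mulEquiv (by norm_num) hη' hη
          exact Or.inr (Or.inl ⟨φ.trans ψ⟩)
      · by_cases hθ' : θ' = 1
        · obtain ⟨ψ⟩ := CyclicSq.nonempty_mulEquiv_of_eq_one (a := 2) (b := 3) (by norm_num) hθ'
          exact Or.inl ⟨φ.trans ψ.symm⟩
        · obtain ⟨ψ⟩ := CyclicSq.nonempty_slSemidirect_mulEquiv (by norm_num) hθ' hθ
          exact Or.inr (Or.inr ⟨φ.trans ψ⟩)
    · rintro (⟨⟨φ⟩⟩ | ⟨⟨φ⟩⟩ | ⟨⟨φ⟩⟩)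
      · exact isOfCentralType_and_natCard_of_mulEquiv (by norm_num) (φ.trans ab')
      · exact isOfCentralType_and_natCard_of_mulEquiv (by norm_num) φ
      · exact isOfCentralType_and_natCard_of_mulEquiv (by norm_num) φ
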